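/- Let $E$ and $F$ be (real) Banach lattices and let $S, T : E \to F$ be linear operators with $0 \le S \le T$, i.e. $0 \le Sx \le Tx$ for every $0 \le x \in E$. Suppose that $E$ is $\sigma$-Dedekind complete (every nonempty countable subset of $E$ that is bounded above has a supremum) and that $F$ has order continuous norm (if $(x_\alpha)$ is a decreasing net in $F$ with infimum $0$, then $\|x_\alpha\| \to 0$). If $T$ is almost limited completely continuous, then $S$ is almost limited completely continuous. Here a bounded set $A \subset E$ is called almost limited if every weak* null sequence $(f_n)$ in the dual Banach lattice $E'$ which is disjoint (that is, $|f_n| \wedge |f_m| = 0$ in $E'$ for $n \ne m$) converges to zero uniformly on $A$. A bounded linear operator $R : E \to Y$ into a Banach space $Y$ is called almost limited completely continuous (alcc) if $\|Rx_n\| \to 0$ for every weakly null sequence $(x_n)$ in $E$ whose set of terms $\{x_n : n \in \mathbb{N}\}$ is almost limited. -/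

import Mathlib

open Filter Topology

section DualOrder

variable (E : Type*) [NormedAddCommGroup E] [NormedSpace ℝ E] [Lattice E]
  [IsOrderedAddMonoid E]

/-- The canonical order of the topological dual of a Banach lattice:
`f ≤ g` iff `f x ≤ g x` for every positive `x`. -/
@[reducible]
def dualOrder : PartialOrder (StrongDual ℝ E) where
  le f g := ∀ x : E, 0 ≤ x → f x ≤ g x
  le_refl _ _ _ := le_rfl
  le_trans _ _ _ h₁ h₂ x hx := (h₁ x hx).trans (h₂ x hx)
  le_antisymm f g h₁ h₂ := by
    ext x
    have hp := le_antisymm (h₁ x⁺ (posPart_nonneg x)) (h₂ x⁺ (posPart_nonneg x))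
    have hn := le_antisymm (h₁ x⁻ (negPart_nonneg x)) (h₂ x⁻ (negPart_nonneg x))
    rw [← posPart_sub_negPart x, map_sub, map_sub, hp, hn]

variable {E}

/-- Disjointness in the dual Banach lattice: `|f| ⊓ |g| = 0`, where the modulus
`|f| = f ⊔ (-f)`, the modulus `|g| = g ⊔ (-g)` and the infimum are taken in the canonical order
of the dual. (The dual of a Banach lattice is a vector lattice, so these suprema and the infimum
always exist.) -/
def DualDisjoint (f g : StrongDual ℝ E) : Prop :=
  letI : PartialOrder (StrongDual ℝ E) := dualOrder E
  ∃ a b : StrongDual ℝ E, IsLUB {f, -f} a ∧ IsLUB {g, -g} b ∧ IsGLB {a, b} 0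

/-- A set is almost limited if it is norm bounded and every disjoint weak* null sequence of the
dual converges to zero uniformly on it. -/
def IsAlmostLimited (A : Set E) : Prop :=
  Bornology.IsBounded A ∧
    ∀ f : ℕ → StrongDual ℝ E, Pairwise (fun m n => DualDisjoint (f m) (f n)) →
      Tendsto (fun n => StrongDual.toWeakDual (f n)) atTop (𝓝 0) →
      TendstoUniformlyOn (fun n x => f n x) (fun _ => 0) atTop A

/-- Almost limited completely continuous operators: bounded linear operators that map every
weakly null sequence whose set of terms is almost limited to a norm null sequence. -/
structure IsAlmostLimitedCompletelyContinuous {Y : Type*} [NormedAddCommGroup Y]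
    [NormedSpace ℝ Y] (T : E →ₗ[ℝ] Y) : Prop where
  continuous : Continuous T
  tendsto_zero : ∀ x : ℕ → E, IsAlmostLimited (Set.range x) →
    Tendsto (fun n => toWeakSpace ℝ E (x n)) atTop (𝓝 0) →
    Tendsto (fun n => T (x n)) atTop (𝓝 0)

end DualOrder

/-- `σ`-Dedekind completeness: every nonempty countable set that is bounded above has a
supremum. -/
def IsSigmaDedekindComplete (E : Type*) [Lattice E] : Prop :=
  ∀ s : Set E, s.Nonempty → s.Countable → BddAbove s → ∃ a, IsLUB s a

/-- Order continuity of the norm: `x_α ↓ 0` implies `‖x_α‖ → 0` for every net. It is enough to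
index the nets by directed sets in the universe of the space, since a decreasing net may be
replaced by its range, directed downwards. -/
def HasOrderContinuousNorm.{v} (F : Type v) [NormedAddCommGroup F] [Lattice F] : Prop :=
  ∀ (ι : Type v) [Preorder ι] [IsDirectedOrder ι] [Nonempty ι] (x : ι → F),
    Antitone x → IsGLB (Set.range x) 0 → Tendsto (fun i => ‖x i‖) atTop (𝓝 0)

/-!
Let `x` be an almost limited weakly null sequence. Two facts about such sequences carry the proof.

*Truncation* (`IsAlmostLimitedWeaklyNull.exists_eventually_norm_map_posPart_sub_le`). For every
`ε > 0` there is `u ≥ 0` with `‖T (x n - u)⁺‖ ≤ ε` eventually, and likewise for `-x`. Otherwise a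
subsequence has large disjoint excesses, which are dominated by `Q k (x (m k))` for orthogonal order projections `Q k`.
The sequence `Q k (x (m k))` is again almost limited and weakly null
(`IsAlmostLimitedWeaklyNull.disjoint_subseq`), so `T` maps it to a norm null sequence, a
contradiction. Both properties come from Phillips' lemma (`eventually_forall_abs_singleton_lt`),
applied to the set functions `A ↦ f (∑ k ∈ A, Q k y)`; these exist by `σ`-Dedekind completeness.

*Approximation* (`exists_approx_on_interval`). For a positive functional `φ` and `u ≥ 0`, the
operator `S` is approximated on `[0, u]`, in the seminorm `φ |·|`, by operators
`R = ∑ c i • P i ∘ T ∘ Q i` with `0 ≤ c i ≤ 1`, where `P i`, `Q i` are positive and the `Q i` preserve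
almost limited weakly null sequences; hence `R (x n) → 0`. This is an approximate Radon–Nikodym
theorem for the finitely additive measures `(P, Q) ↦ φ (P S Q u)` and `(P, Q) ↦ φ (P T Q u)`, the
first dominated by the second: the energy `∑ φ(P i S Q i u)² / φ(P i T Q i u)` of a partition
increases under refinement and is bounded, and along a partition of nearly maximal energy the
quotients `c i` hardly change under refinement.

Together these give `φ |S (x n)| → 0` for every positive functional `φ`. By truncation, `|S (x n)|`
is up to a small norm contained in the order interval `[0, T (2 u)]`, where, the norm of the range
being order continuous, smallness in norm is controlled by a single positive functional
(`HasOrderContinuousNorm.exists_dual_norm_le`). Hence `‖S (x n)‖ → 0`.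
-/

/-! ### Phillips' lemma for finitely additive set functions -/

lemma sum_eq_biUnion_of_additive {μ : Set ℕ → ℝ}
    (hadd : ∀ A B, Disjoint A B → μ (A ∪ B) = μ A + μ B) {B : ℕ → Set ℕ}
    (hB : Pairwise (fun i j => Disjoint (B i) (B j))) (s : Finset ℕ) :
    ∑ i ∈ s, μ (B i) = μ (⋃ i ∈ s, B i) := by
  classical
  induction s using Finset.induction_on with
  | empty =>
    have h := hadd ∅ ∅ (by simp)
    simp only [Set.union_empty] at h
    simp only [Finset.sum_empty, Finset.notMem_empty, Set.iUnion_of_empty, Set.iUnion_empty]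
    linarith
  | insert a s ha ih =>
    rw [Finset.sum_insert ha, Finset.set_biUnion_insert, hadd, ih]
    rw [Set.disjoint_iUnion₂_right]
    intro i hi
    exact hB (fun h => ha (h ▸ hi))

/-- Among infinitely many disjoint infinite pieces of `N`, one carries at most `δ` of the variation
of `μ`, since the total variation of `μ` is at most `2 * C`. -/
lemma exists_infinite_subset_abs_le {μ : Set ℕ → ℝ}
    (hadd : ∀ A B, Disjoint A B → μ (A ∪ B) = μ A + μ B) {C : ℝ} (hC : ∀ A, |μ A| ≤ C)
    {N : Set ℕ} (hN : N.Infinite) {δ : ℝ} (hδ : 0 < δ) :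
    ∃ N' ⊆ N, N'.Infinite ∧ ∀ B ⊆ N', |μ B| ≤ δ := by
  classical
  by_contra! hcon
  let e : ℕ → ℕ := fun n => hN.natEmbedding N n
  have he : Function.Injective e := fun a b h => (hN.natEmbedding N).injective (Subtype.ext h)
  let M : ℕ → Set ℕ := fun i => Set.range fun j => e (Nat.pair i j)
  have hMN : ∀ i, M i ⊆ N := by
    rintro i _ ⟨j, rfl⟩
    exact (hN.natEmbedding N _).2
  have hMinf : ∀ i, (M i).Infinite := fun i =>
    Set.infinite_range_of_injective fun a b h => by
      have := he h
      rw [Nat.pair_eq_pair] at this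
      exact this.2
  choose B hBM hB using fun i => hcon (M i) (hMN i) (hMinf i)
  have hdisj : Pairwise fun i j => Disjoint (B i) (B j) := by
    intro i j hij
    refine Disjoint.mono (hBM i) (hBM j) (Set.disjoint_left.2 ?_)
    rintro _ ⟨a, rfl⟩ ⟨b, hb⟩
    have := he hb
    rw [Nat.pair_eq_pair] at this
    exact hij this.1.symm
  have hle : ∀ s : Finset ℕ, |∑ i ∈ s, μ (B i)| ≤ C := fun s => by
    rw [sum_eq_biUnion_of_additive hadd hdisj]
    exact hC _
  have hbound : ∀ s : Finset ℕ, ∑ i ∈ s, |μ (B i)| ≤ 2 * C := fun s => by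
    rw [← Finset.sum_filter_add_sum_filter_not s (fun i => 0 ≤ μ (B i))]
    have h1 : ∑ i ∈ s with 0 ≤ μ (B i), |μ (B i)| = ∑ i ∈ s with 0 ≤ μ (B i), μ (B i) :=
      Finset.sum_congr rfl fun i hi => abs_of_nonneg (Finset.mem_filter.1 hi).2
    have h2 : ∑ i ∈ s with ¬ 0 ≤ μ (B i), |μ (B i)| = -∑ i ∈ s with ¬ 0 ≤ μ (B i), μ (B i) := by
      rw [← Finset.sum_neg_distrib]
      exact Finset.sum_congr rfl fun i hi =>
        abs_of_nonpos (not_le.1 (Finset.mem_filter.1 hi).2).le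
    rw [h1, h2]
    have h3 := abs_le.1 (hle (s.filter fun i => 0 ≤ μ (B i)))
    have h4 := abs_le.1 (hle (s.filter fun i => ¬ 0 ≤ μ (B i)))
    linarith [h3.2, h4.1]
  obtain ⟨K, hK⟩ := exists_nat_gt (2 * C / δ)
  have h5 : (K : ℝ) * δ ≤ ∑ i ∈ Finset.range K, |μ (B i)| := by
    have := Finset.card_nsmul_le_sum (Finset.range K) (fun i => |μ (B i)|) δ
      (fun i _ => (hB i).le)
    simpa using this
  have h6 := hbound (Finset.range K)
  rw [div_lt_iff₀ hδ] at hK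
  linarith

/-- The diagonal case of Phillips' lemma, by a sliding hump. The supports `N' n` of small variation
are fixed beforehand, so the points of the hump can be chosen one after the other. -/
lemma exists_abs_singleton_lt_of_tendsto {ν : ℕ → Set ℕ → ℝ}
    (hadd : ∀ n A B, Disjoint A B → ν n (A ∪ B) = ν n A + ν n B)
    (hbdd : ∀ n, ∃ C, ∀ A, |ν n A| ≤ C)
    (hlim : ∀ A, Tendsto (fun n => ν n A) atTop (𝓝 0)) {ε : ℝ} (hε : 0 < ε) :
    ∃ n, |ν n {n}| < ε := by
  classical
  by_contra! hcon
  have hstep : ∀ (n : ℕ) (N : {N : Set ℕ // N.Infinite}), ∃ N' : {N : Set ℕ // N.Infinite},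
      N'.1 ⊆ N.1 ∧ ∀ B ⊆ N'.1, |ν n B| ≤ ε / 4 := by
    rintro n ⟨N, hN⟩
    obtain ⟨C, hC⟩ := hbdd n
    obtain ⟨N', h1, h2, h3⟩ := exists_infinite_subset_abs_le (hadd n) hC hN
      (δ := ε / 4) (by positivity)
    exact ⟨⟨N', h2⟩, h1, h3⟩
  choose G hG1 hG2 using hstep
  let N : ℕ → {N : Set ℕ // N.Infinite} := fun n =>
    Nat.rec ⟨Set.univ, Set.infinite_univ⟩ (fun k N => G k N) n
  have hNsucc : ∀ n, N (n + 1) = G n (N n) := fun n => rfl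
  have hanti : Antitone fun n => (N n).1 := antitone_nat_of_succ_le fun n => by
    rw [hNsucc]
    exact hG1 n (N n)
  have hsmall : ∀ n, ∀ B ⊆ (N (n + 1)).1, |ν n B| ≤ ε / 4 := fun n => by
    rw [hNsucc]
    exact hG2 n (N n)
  obtain ⟨p, -, hp⟩ := exists_seq_of_forall_finset_exists (fun _ : ℕ => True)
    (fun x y => x < y ∧ y ∈ (N (x + 1)).1 ∧ |ν y {x}| ≤ ε / 8 * (1 / 2) ^ x) (by
      intro s _
      have hev : ∀ᶠ y in atTop, ∀ x ∈ s, |ν y {x}| ≤ ε / 8 * (1 / 2) ^ x := by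
        rw [Finset.eventually_all]
        intro x _
        have := (hlim {x}).abs
        rw [abs_zero] at this
        exact this.eventually (eventually_le_nhds (by positivity))
      obtain ⟨m, hm⟩ := eventually_atTop.1 hev
      obtain ⟨y, hy, hym⟩ := (N (s.sup id + 1)).2.exists_gt (max m (s.sup id))
      refine ⟨y, trivial, fun x hx => ?_⟩
      have hxs : x ≤ s.sup id := Finset.le_sup (f := id) hx
      exact ⟨lt_of_le_of_lt (hxs.trans (le_max_right _ _)) hym,
        hanti (Nat.succ_le_succ hxs) hy, hm y ((le_max_left _ _).trans hym.le) x hx⟩)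
  have hmono : StrictMono p := fun i j hij => (hp i j hij).1
  have hsplit : ∀ i, Set.range p =
      ((⋃ l ∈ Finset.range i, {p l}) ∪ {p i}) ∪ p '' Set.Ioi i := by
    intro i
    ext y
    constructor
    · rintro ⟨j, rfl⟩
      rcases lt_trichotomy j i with h | h | h
      · left; left
        simp only [Set.mem_iUnion, Set.mem_singleton_iff]
        exact ⟨j, Finset.mem_range.2 h, rfl⟩
      · left; right
        simp [h]
      · right
        exact ⟨j, h, rfl⟩
    · rintro ((h | h) | ⟨j, _, rfl⟩)
      · simp only [Set.mem_iUnion, Set.mem_singleton_iff] at h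
        obtain ⟨j, _, rfl⟩ := h
        exact ⟨j, rfl⟩
      · rw [Set.mem_singleton_iff.1 h]
        exact ⟨i, rfl⟩
      · exact ⟨j, rfl⟩
  have hlow : ∀ i, ε / 2 ≤ |ν (p i) (Set.range p)| := by
    intro i
    have hd1 : Disjoint (⋃ l ∈ Finset.range i, {p l}) ({p i} : Set ℕ) := by
      rw [Set.disjoint_singleton_right]
      simp only [Set.mem_iUnion, Set.mem_singleton_iff, Finset.mem_range, not_exists]
      intro l hl h
      exact (hmono hl).ne h.symm
    have hd2 : Disjoint ((⋃ l ∈ Finset.range i, {p l}) ∪ {p i}) (p '' Set.Ioi i) := by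
      rw [Set.disjoint_right]
      rintro _ ⟨j, hj, rfl⟩ (h | h)
      · simp only [Set.mem_iUnion, Set.mem_singleton_iff, Finset.mem_range] at h
        obtain ⟨l, hl, h⟩ := h
        exact (hmono (hl.trans hj)).ne' h
      · exact (hmono hj).ne' h
    have h1 : |ν (p i) (p '' Set.Ioi i)| ≤ ε / 4 := by
      apply hsmall
      rintro _ ⟨j, hj, rfl⟩
      exact (hp i j hj).2.1
    have h2 : |ν (p i) (⋃ l ∈ Finset.range i, {p l})| ≤ ε / 4 := by
      rw [← sum_eq_biUnion_of_additive (hadd (p i)) (B := fun l => {p l}) (by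
        intro a b hab
        exact Set.disjoint_singleton.2 (hmono.injective.ne hab))]
      calc |∑ l ∈ Finset.range i, ν (p i) {p l}|
          ≤ ∑ l ∈ Finset.range i, |ν (p i) {p l}| := Finset.abs_sum_le_sum_abs _ _
        _ ≤ ∑ l ∈ Finset.range i, ε / 8 * (1 / 2) ^ l := by
            refine Finset.sum_le_sum fun l hl => ((hp l i (Finset.mem_range.1 hl)).2.2).trans ?_
            exact mul_le_mul_of_nonneg_left
              (pow_le_pow_of_le_one (by norm_num) (by norm_num) (hmono.id_le l)) (by positivity)
        _ = ε / 8 * ∑ l ∈ Finset.range i, (1 / 2) ^ l := by rw [Finset.mul_sum]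
        _ ≤ ε / 8 * 2 := mul_le_mul_of_nonneg_left (sum_geometric_two_le i) (by positivity)
        _ = ε / 4 := by ring
    have h3 := hcon (p i)
    rw [hsplit i, hadd _ _ _ hd2, hadd _ _ _ hd1]
    have h4 := abs_le.1 h1
    have h5 := abs_le.1 h2
    rcases le_abs.1 h3 with h | h
    · exact le_abs.2 (Or.inl (by linarith))
    · exact le_abs.2 (Or.inr (by linarith))
  have h1 := ((hlim (Set.range p)).comp hmono.tendsto_atTop).abs
  rw [abs_zero] at h1
  obtain ⟨i, hi⟩ := (h1.eventually (gt_mem_nhds (half_pos hε))).exists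
  exact absurd (hlow i) (not_le.2 hi)

/-- **Phillips' lemma**: if bounded finitely additive set functions on the subsets of `ℕ` tend to
zero on every set, they tend to zero on singletons, uniformly over the singletons. -/
lemma eventually_forall_abs_singleton_lt {ν : ℕ → Set ℕ → ℝ}
    (hadd : ∀ n A B, Disjoint A B → ν n (A ∪ B) = ν n A + ν n B)
    (hbdd : ∀ n, ∃ C, ∀ A, |ν n A| ≤ C)
    (hlim : ∀ A, Tendsto (fun n => ν n A) atTop (𝓝 0)) {ε : ℝ} (hε : 0 < ε) :
    ∀ᶠ n in atTop, ∀ k, |ν n {k}| < ε := by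
  classical
  by_contra hcon
  rw [not_eventually] at hcon
  -- Distinct rows with a large entry can be chosen in distinct columns, as columns tend to zero.
  obtain ⟨q, hq, hqq⟩ := exists_seq_of_forall_finset_exists (fun q : ℕ × ℕ => ε ≤ |ν q.1 {q.2}|)
    (fun x y => x.1 < y.1 ∧ x.2 ≠ y.2) (by
      intro s _
      have hev : ∀ᶠ n in atTop, ∀ x ∈ s, |ν n {x.2}| < ε := by
        rw [Finset.eventually_all]
        intro x _
        have := (hlim {x.2}).abs
        rw [abs_zero] at this
        exact this.eventually (gt_mem_nhds hε)
      have hev2 : ∀ᶠ n in atTop, ∀ x ∈ s, x.1 < n := by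
        rw [Finset.eventually_all]
        exact fun x _ => eventually_gt_atTop x.1
      obtain ⟨n, hn, hn1, hn2⟩ := (hcon.and_eventually (hev.and hev2)).exists
      push Not at hn
      obtain ⟨k, hk⟩ := hn
      refine ⟨(n, k), hk, fun x hx => ⟨hn2 x hx, fun h => ?_⟩⟩
      have := hn1 x hx
      rw [h] at this
      exact absurd hk (not_le.2 this))
  have hrow : StrictMono fun j => (q j).1 := fun i j hij => (hqq i j hij).1
  have hcol : Function.Injective fun j => (q j).2 := by
    intro i j hij
    rcases lt_trichotomy i j with h | h | h
    · exact absurd hij (hqq i j h).2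
    · exact h
    · exact absurd hij.symm (hqq j i h).2
  obtain ⟨n, hn⟩ := exists_abs_singleton_lt_of_tendsto
    (ν := fun j A => ν (q j).1 ((fun j => (q j).2) '' A))
    (fun n A B hAB => by
      rw [Set.image_union]
      exact hadd _ _ _ ((Set.disjoint_image_iff hcol).2 hAB))
    (fun n => (hbdd (q n).1).imp fun C hC A => hC _)
    (fun A => (hlim _).comp hrow.tendsto_atTop) hε
  rw [Set.image_singleton] at hn
  exact absurd (hq n) (not_le.2 hn)

/-! ### Order projections -/

section VectorLattice

variable {X : Type*} [NormedAddCommGroup X] [Lattice X] [IsOrderedAddMonoid X]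

lemma add_inf_le_inf_add_inf {x y c : X} (hx : 0 ≤ x) (hy : 0 ≤ y) (hc : 0 ≤ c) :
    (x + y) ⊓ c ≤ x ⊓ c + y ⊓ c := by
  rw [inf_add, add_inf, add_inf]
  refine le_inf (le_inf inf_le_left (inf_le_right.trans ?_))
    (le_inf (inf_le_right.trans ?_) (inf_le_right.trans ?_))
  · exact le_add_of_nonneg_left hx
  · exact le_add_of_nonneg_right hy
  · exact le_add_of_nonneg_right hc

lemma IsLUB.range_add {a b : ℕ → X} (ha : Monotone a) (hb : Monotone b) {α β : X}
    (hα : IsLUB (Set.range a) α) (hβ : IsLUB (Set.range b) β) :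
    IsLUB (Set.range fun n => a n + b n) (α + β) := by
  refine ⟨?_, fun c hc => ?_⟩
  · rintro _ ⟨n, rfl⟩
    exact add_le_add (hα.1 ⟨n, rfl⟩) (hβ.1 ⟨n, rfl⟩)
  · have key : ∀ n m, a n + b m ≤ c := fun n m =>
      (add_le_add (ha (le_max_left n m)) (hb (le_max_right n m))).trans (hc ⟨max n m, rfl⟩)
    rw [← le_sub_iff_add_le]
    refine hα.2 ?_
    rintro _ ⟨n, rfl⟩
    rw [le_sub_iff_add_le, ← le_sub_iff_add_le']
    refine hβ.2 ?_
    rintro _ ⟨m, rfl⟩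
    rw [le_sub_iff_add_le']
    exact key n m

lemma norm_le_norm_of_nonneg_of_le [HasSolidNorm X] {x y : X} (hx : 0 ≤ x) (hxy : x ≤ y) : ‖x‖ ≤ ‖y‖ :=
  norm_le_norm_of_abs_le_abs (by rwa [abs_of_nonneg hx, abs_of_nonneg (hx.trans hxy)])

end VectorLattice

section OrderProjection

variable {X : Type*} [NormedAddCommGroup X] [NormedSpace ℝ X] [Lattice X]

/-- Order projections of a Banach lattice: idempotent operators between `0` and the identity. -/
structure IsOrderProjection (Q : X →L[ℝ] X) : Prop where
  nonneg : ∀ x, 0 ≤ x → 0 ≤ Q x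
  le_self : ∀ x, 0 ≤ x → Q x ≤ x
  idem : ∀ x, Q (Q x) = Q x

variable [IsOrderedAddMonoid X]

lemma abs_map_le_map_abs {Y : Type*} [NormedAddCommGroup Y] [NormedSpace ℝ Y] [Lattice Y]
    [IsOrderedAddMonoid Y] (U V : X →ₗ[ℝ] Y) (h₁ : ∀ x, 0 ≤ x → U x ≤ V x)
    (h₂ : ∀ x, 0 ≤ x → -U x ≤ V x) (x : X) : |U x| ≤ V |x| := by
  have hx : U x = U x⁺ - U x⁻ := by rw [← map_sub, posPart_sub_negPart]
  have hV : V |x| = V x⁺ + V x⁻ := by rw [← map_add, posPart_add_negPart]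
  rw [hx, hV]
  refine abs_le'.2 ⟨?_, ?_⟩
  · rw [sub_eq_add_neg]
    exact add_le_add (h₁ _ (posPart_nonneg _)) (h₂ _ (negPart_nonneg _))
  · rw [neg_sub, sub_eq_neg_add]
    exact add_le_add (h₂ _ (posPart_nonneg _)) (h₁ _ (negPart_nonneg _))

lemma map_mono_of_nonneg {Y : Type*} [NormedAddCommGroup Y] [NormedSpace ℝ Y] [PartialOrder Y]
    [IsOrderedAddMonoid Y] {U : X →ₗ[ℝ] Y} (h : ∀ x, 0 ≤ x → 0 ≤ U x) {x y : X}
    (hxy : x ≤ y) : U x ≤ U y := by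
  have := h (y - x) (sub_nonneg.2 hxy)
  rwa [map_sub, sub_nonneg] at this

lemma IsOrderProjection.one_sub {Q : X →L[ℝ] X} (hQ : IsOrderProjection Q) :
    IsOrderProjection (1 - Q) where
  nonneg x hx := by simpa using hQ.le_self x hx
  le_self x hx := by simpa using hQ.nonneg x hx
  idem x := by simp [hQ.idem]

/-- Elements below the range of an order projection are fixed by it. -/
lemma IsOrderProjection.apply_eq_self_of_le {Q : X →L[ℝ] X} (hQ : IsOrderProjection Q) {x y : X}
    (hx : 0 ≤ x) (hxy : x ≤ y) (hy : Q y = y) : Q x = x := by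
  refine le_antisymm (hQ.le_self x hx) ?_
  have h := hQ.one_sub.nonneg (y - x) (sub_nonneg.2 hxy)
  simp only [sub_apply, one_apply_eq_self, map_sub, hy] at h
  simpa using h

variable [HasSolidNorm X]

lemma IsOrderProjection.norm_apply_le {Q : X →L[ℝ] X} (hQ : IsOrderProjection Q) (x : X) :
    ‖Q x‖ ≤ ‖x‖ := by
  refine norm_le_norm_of_abs_le_abs ?_
  exact abs_map_le_map_abs Q.toLinearMap LinearMap.id hQ.le_self
    (fun x hx => (neg_nonpos.2 (hQ.nonneg x hx)).trans hx) x

/-- An additive map of the positive cone below the identity extends to a bounded operator. -/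
lemma exists_clm_eq_of_additive {g : X → X} (h₀ : ∀ x, 0 ≤ x → 0 ≤ g x)
    (h₁ : ∀ x, 0 ≤ x → g x ≤ x) (hadd : ∀ x y, 0 ≤ x → 0 ≤ y → g (x + y) = g x + g y) :
    ∃ Q : X →L[ℝ] X, ∀ x, 0 ≤ x → Q x = g x := by
  have hg0 : g 0 = 0 := le_antisymm (h₁ 0 le_rfl) (h₀ 0 le_rfl)
  let f : X →+ X := AddMonoidHom.mk' (fun x => g x⁺ - g x⁻) (by
    intro x y
    have e : (x + y)⁺ + (x⁻ + y⁻) = (x + y)⁻ + (x⁺ + y⁺) := by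
      have h1 := posPart_sub_negPart (x + y)
      have h2 := posPart_sub_negPart x
      have h3 := posPart_sub_negPart y
      rw [← sub_eq_zero] at h1 h2 h3 ⊢
      calc _ = ((x + y)⁺ - (x + y)⁻ - (x + y)) - (x⁺ - x⁻ - x) - (y⁺ - y⁻ - y) := by abel
        _ = 0 := by rw [h1, h2, h3]; simp
    have e2 := congrArg g e
    rw [hadd _ _ (posPart_nonneg _) (add_nonneg (negPart_nonneg _) (negPart_nonneg _)),
      hadd _ _ (negPart_nonneg _) (add_nonneg (posPart_nonneg _) (posPart_nonneg _)),
      hadd _ _ (posPart_nonneg _) (posPart_nonneg _),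
      hadd _ _ (negPart_nonneg _) (negPart_nonneg _)] at e2
    rw [← sub_eq_zero] at e2 ⊢
    rw [← e2]
    abel)
  have hfx : ∀ x, f x = g x⁺ - g x⁻ := fun x => rfl
  have hcont : Continuous f := AddMonoidHomClass.continuous_of_bound f 1 fun x => by
    rw [one_mul]
    refine norm_le_norm_of_abs_le_abs ?_
    rw [hfx, ← posPart_add_negPart x]
    have hp := h₁ _ (posPart_nonneg x)
    have hn := h₁ _ (negPart_nonneg x)
    have hp0 := h₀ _ (posPart_nonneg x)
    have hn0 := h₀ _ (negPart_nonneg x)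
    refine abs_le'.2 ⟨?_, ?_⟩
    · exact (sub_le_self _ hn0).trans (hp.trans (le_add_of_nonneg_right (negPart_nonneg x)))
    · rw [neg_sub]
      exact (sub_le_self _ hp0).trans (hn.trans (le_add_of_nonneg_left (posPart_nonneg x)))
  refine ⟨f.toRealLinearMap hcont, fun x hx => ?_⟩
  simp only [AddMonoidHom.coe_toRealLinearMap]
  rw [hfx, posPart_of_nonneg hx, negPart_of_nonneg hx, hg0, sub_zero]

/-- The pointwise supremum of an increasing sequence of maps of the positive cone that is additive
in the limit is a bounded operator. -/
lemma IsSigmaDedekindComplete.exists_clm_isLUB (hX : IsSigmaDedekindComplete X)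
    {G : ℕ → X → X} (h₀ : ∀ n x, 0 ≤ x → 0 ≤ G n x) (h₁ : ∀ n x, 0 ≤ x → G n x ≤ x)
    (hmono : ∀ x, 0 ≤ x → Monotone fun n => G n x)
    (hsub : ∀ n x y, 0 ≤ x → 0 ≤ y → G n (x + y) ≤ G n x + G n y)
    (hsup : ∀ n x y, 0 ≤ x → 0 ≤ y → ∃ m, G n x + G n y ≤ G m (x + y)) :
    ∃ Q : X →L[ℝ] X, ∀ x, 0 ≤ x → IsLUB (Set.range fun n => G n x) (Q x) := by
  have hex : ∀ x, 0 ≤ x → ∃ a, IsLUB (Set.range fun n => G n x) a := fun x hx =>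
    hX _ (Set.range_nonempty _) (Set.countable_range _) ⟨x, by
      rintro _ ⟨n, rfl⟩
      exact h₁ n x hx⟩
  choose! g hg using hex
  obtain ⟨Q, hQ⟩ := exists_clm_eq_of_additive (g := g)
    (fun x hx => (h₀ 0 x hx).trans ((hg x hx).1 ⟨0, rfl⟩))
    (fun x hx => (hg x hx).2 (by
      rintro _ ⟨n, rfl⟩
      exact h₁ n x hx))
    (by
      intro x y hx hy
      have hxy := (hg x hx).range_add (hmono x hx) (hmono y hy) (hg y hy)
      refine le_antisymm ((hg _ (add_nonneg hx hy)).2 ?_) (hxy.2 ?_)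
      · rintro _ ⟨n, rfl⟩
        exact (hsub n x y hx hy).trans (hxy.1 ⟨n, rfl⟩)
      · rintro _ ⟨n, rfl⟩
        obtain ⟨m, hm⟩ := hsup n x y hx hy
        exact hm.trans ((hg _ (add_nonneg hx hy)).1 ⟨m, rfl⟩))
  exact ⟨Q, fun x hx => by
    rw [hQ x hx]
    exact hg x hx⟩

/-- The projection onto the band generated by `v`, given by `x ↦ sup (x ⊓ n v)` for `0 ≤ x`. -/
lemma IsSigmaDedekindComplete.exists_orderProjection (hX : IsSigmaDedekindComplete X) {v : X}
    (hv : 0 ≤ v) :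
    ∃ Q : X →L[ℝ] X, IsOrderProjection Q ∧ Q v = v ∧ ∀ z, 0 ≤ z → z ⊓ v = 0 → Q z = 0 := by
  have hnv : ∀ n : ℕ, 0 ≤ n • v := fun n => nsmul_nonneg hv n
  obtain ⟨Q, hQ⟩ := hX.exists_clm_isLUB (G := fun n x => x ⊓ n • v)
    (fun n x hx => le_inf hx (hnv n)) (fun n x _ => inf_le_left)
    (fun x _ n m hnm => inf_le_inf_left _ (nsmul_le_nsmul_left hv hnm))
    (fun n x y hx hy => add_inf_le_inf_add_inf hx hy (hnv n))
    (fun n x y _ _ => ⟨n + n, le_inf (add_le_add inf_le_left inf_le_left) (by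
      rw [add_nsmul]
      exact add_le_add inf_le_right inf_le_right)⟩)
  have h0 : ∀ x, 0 ≤ x → 0 ≤ Q x := fun x hx =>
    (le_inf hx (hnv 0)).trans ((hQ x hx).1 ⟨0, rfl⟩)
  have h1 : ∀ x, 0 ≤ x → Q x ≤ x := fun x hx => (hQ x hx).2 (by
    rintro _ ⟨n, rfl⟩
    exact inf_le_left)
  have hpos : ∀ x, 0 ≤ x → Q (Q x) = Q x := by
    intro x hx
    refine le_antisymm (h1 _ (h0 x hx)) ((hQ x hx).2 ?_)
    rintro _ ⟨n, rfl⟩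
    have hle : x ⊓ n • v ≤ Q x := (hQ x hx).1 ⟨n, rfl⟩
    refine le_trans ?_ ((hQ _ (h0 x hx)).1 ⟨n, rfl⟩)
    exact le_inf hle inf_le_right
  refine ⟨Q, ⟨h0, h1, fun x => ?_⟩, ?_, ?_⟩
  · rw [← posPart_sub_negPart x, map_sub, map_sub, hpos _ (posPart_nonneg x),
      hpos _ (negPart_nonneg x)]
  · refine le_antisymm (h1 v hv) ?_
    have := (hQ v hv).1 ⟨1, rfl⟩
    simpa using this
  · intro z hz hzv
    refine le_antisymm ((hQ z hz).2 ?_) (h0 z hz)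
    rintro _ ⟨n, rfl⟩
    change z ⊓ n • v ≤ 0
    induction n with
    | zero => simp
    | succ n ih =>
      rw [succ_nsmul]
      calc z ⊓ (n • v + v) = (n • v + v) ⊓ z := inf_comm _ _
        _ ≤ n • v ⊓ z + v ⊓ z := add_inf_le_inf_add_inf (hnv n) hv hz
        _ ≤ 0 := by
          rw [inf_comm v z, hzv, add_zero, inf_comm]
          exact ih

end OrderProjection

/-! ### Almost limited weakly null sequences -/

lemma tendsto_toWeakSpace_zero_iff {X : Type*} [NormedAddCommGroup X] [NormedSpace ℝ X]
    {x : ℕ → X} : Tendsto (fun n => toWeakSpace ℝ X (x n)) atTop (𝓝 0) ↔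
      ∀ φ : StrongDual ℝ X, Tendsto (fun n => φ (x n)) atTop (𝓝 0) := by
  refine (WeakBilin.tendsto_iff_forall_eval_tendsto (topDualPairing ℝ X).flip ?_).trans ?_
  swap
  · refine forall_congr' fun φ => ?_
    rw [← map_zero φ]
    rfl
  · intro a b hab
    exact (SeparatingDual.eq_iff_forall_dual_eq (R := ℝ)).2 fun φ => LinearMap.congr_fun hab φ

lemma tendsto_toWeakDual_zero_iff {X : Type*} [NormedAddCommGroup X] [NormedSpace ℝ X]
    {f : ℕ → StrongDual ℝ X} : Tendsto (fun n => StrongDual.toWeakDual (f n)) atTop (𝓝 0) ↔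
      ∀ x : X, Tendsto (fun n => f n x) atTop (𝓝 0) := by
  rw [tendsto_iff_forall_eval_tendsto_topDualPairing]
  rfl

section TestSequence

variable {X : Type*} [NormedAddCommGroup X] [NormedSpace ℝ X] [Lattice X] [IsOrderedAddMonoid X]

lemma clm_ext_of_nonneg {Y : Type*} [NormedAddCommGroup Y] [NormedSpace ℝ Y]
    {Q R : X →L[ℝ] Y} (h : ∀ x, 0 ≤ x → Q x = R x) : Q = R := by
  ext x
  rw [← posPart_sub_negPart x, map_sub, map_sub, h _ (posPart_nonneg x), h _ (negPart_nonneg x)]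

/-- Disjointness in the dual is inherited by `f ∘ Q` and `g ∘ R`: the modulus of `f ∘ Q` is
`|f| ∘ Q`, and `0 ≤ |f| ∘ Q ≤ |f|`. -/
lemma DualDisjoint.comp_orderProjection {f g : StrongDual ℝ X} (h : DualDisjoint f g)
    {Q R : X →L[ℝ] X} (hQ : IsOrderProjection Q) (hR : IsOrderProjection R) :
    DualDisjoint (f ∘L Q) (g ∘L R) := by
  have key : ∀ (f a : StrongDual ℝ X) (Q : X →L[ℝ] X), IsOrderProjection Q →
      (letI : PartialOrder (StrongDual ℝ X) := dualOrder X; IsLUB {f, -f} a) →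
      (∀ x, 0 ≤ x → 0 ≤ a x) ∧
      (letI : PartialOrder (StrongDual ℝ X) := dualOrder X;
        IsLUB {f ∘L Q, -(f ∘L Q)} (a ∘L Q)) := by
    intro f a Q hQ ha
    let : PartialOrder (StrongDual ℝ X) := dualOrder X
    have h1 : ∀ x, 0 ≤ x → f x ≤ a x := ha.1 (Set.mem_insert _ _)
    have h2 : ∀ x, 0 ≤ x → -f x ≤ a x := ha.1 (Set.mem_insert_of_mem _ rfl)
    have h0 : ∀ x, 0 ≤ x → 0 ≤ a x := fun x hx => by linarith [h1 x hx, h2 x hx]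
    refine ⟨h0, ?_, ?_⟩
    · rintro _ (rfl | rfl)
      · exact fun x hx => h1 _ (hQ.nonneg x hx)
      · exact fun x hx => h2 _ (hQ.nonneg x hx)
    · intro b hb x hx
      have hb1 : ∀ x, 0 ≤ x → f (Q x) ≤ b x := hb (Set.mem_insert _ _)
      have hb2 : ∀ x, 0 ≤ x → -f (Q x) ≤ b x := hb (Set.mem_insert_of_mem _ rfl)
      have hb0 : ∀ x, 0 ≤ x → 0 ≤ b x := fun x hx => by linarith [hb1 x hx, hb2 x hx]
      -- `b + a ∘ (1 - Q)` is an upper bound of `f` and `-f`, hence at least `a`.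
      have hle : ∀ y, 0 ≤ y → a y ≤ (b + (a ∘L (1 - Q) : StrongDual ℝ X)) y := by
        refine ha.2 ?_
        rintro _ (rfl | rfl) y hy
        · have e1 := hb1 y hy
          have e2 := h1 _ (hQ.one_sub.nonneg y hy)
          simp only [add_apply, ContinuousLinearMap.comp_apply,
            sub_apply, one_apply_eq_self, map_sub] at e2 ⊢
          linarith
        · have e1 := hb2 y hy
          have e2 := h2 _ (hQ.one_sub.nonneg y hy)
          simp only [add_apply, ContinuousLinearMap.comp_apply,
            sub_apply, one_apply_eq_self,
            neg_apply, map_sub] at e2 ⊢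
          linarith
      have e := hle (Q x) (hQ.nonneg x hx)
      have e2 := hb0 _ (hQ.one_sub.nonneg x hx)
      simp only [add_apply, ContinuousLinearMap.comp_apply,
            sub_apply, one_apply_eq_self, map_sub, hQ.idem] at e e2
      change a (Q x) ≤ b x
      linarith
  obtain ⟨a, b, ha, hb, hab⟩ := h
  obtain ⟨ha0, ha'⟩ := key f a Q hQ ha
  obtain ⟨hb0, hb'⟩ := key g b R hR hb
  refine ⟨a ∘L Q, b ∘L R, ha', hb', ?_, ?_⟩
  · rintro _ (rfl | rfl)
    · exact fun x hx => ha0 _ (hQ.nonneg x hx)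
    · exact fun x hx => hb0 _ (hR.nonneg x hx)
  · intro c hc
    let : PartialOrder (StrongDual ℝ X) := dualOrder X
    have hc1 : ∀ x, 0 ≤ x → c x ≤ a (Q x) := hc (Set.mem_insert _ _)
    have hc2 : ∀ x, 0 ≤ x → c x ≤ b (R x) := hc (Set.mem_insert_of_mem _ rfl)
    refine hab.2 ?_
    rintro _ (rfl | rfl)
    · intro x hx
      have := ha0 _ (hQ.one_sub.nonneg x hx)
      simp only [sub_apply, one_apply_eq_self, map_sub] at this
      linarith [hc1 x hx]
    · intro x hx
      have := hb0 _ (hR.one_sub.nonneg x hx)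
      simp only [sub_apply, one_apply_eq_self, map_sub] at this
      linarith [hc2 x hx]

/-- Weakly null sequences with almost limited range: those on which almost limited completely
continuous operators are tested. -/
structure IsAlmostLimitedWeaklyNull (x : ℕ → X) : Prop where
  isAlmostLimited : IsAlmostLimited (Set.range x)
  tendsto_dual : ∀ φ : StrongDual ℝ X, Tendsto (fun n => φ (x n)) atTop (𝓝 0)

lemma isAlmostLimited_range_iff {x : ℕ → X} : IsAlmostLimited (Set.range x) ↔
    (∃ C, ∀ n, ‖x n‖ ≤ C) ∧
    ∀ f : ℕ → StrongDual ℝ X, Pairwise (fun m n => DualDisjoint (f m) (f n)) →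
      (∀ y, Tendsto (fun n => f n y) atTop (𝓝 0)) →
      ∀ ε > 0, ∀ᶠ m in atTop, ∀ n, |f m (x n)| < ε := by
  unfold IsAlmostLimited
  refine and_congr ?_ ?_
  · rw [isBounded_iff_forall_norm_le]
    simp
  · refine forall_congr' fun f => forall_congr' fun _ => ?_
    rw [tendsto_toWeakDual_zero_iff, Metric.tendstoUniformlyOn_iff]
    simp

lemma IsAlmostLimitedWeaklyNull.neg {x : ℕ → X} (hx : IsAlmostLimitedWeaklyNull x) :
    IsAlmostLimitedWeaklyNull fun n => -x n where
  isAlmostLimited := by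
    have := hx.isAlmostLimited
    rw [isAlmostLimited_range_iff] at this ⊢
    simpa using this
  tendsto_dual φ := by simpa using (hx.tendsto_dual φ).neg

variable [HasSolidNorm X]

lemma IsAlmostLimitedWeaklyNull.map_orderProjection {x : ℕ → X}
    (hx : IsAlmostLimitedWeaklyNull x) {Q : X →L[ℝ] X} (hQ : IsOrderProjection Q) :
    IsAlmostLimitedWeaklyNull fun n => Q (x n) where
  isAlmostLimited := by
    have := hx.isAlmostLimited
    rw [isAlmostLimited_range_iff] at this ⊢
    refine ⟨this.1.imp fun C hC n => (hQ.norm_apply_le _).trans (hC n), fun f hf hlim => ?_⟩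
    exact this.2 (fun m => f m ∘L Q) (fun m n hmn => (hf hmn).comp_orderProjection hQ hQ)
      (fun y => hlim (Q y))
  tendsto_dual φ := hx.tendsto_dual (φ ∘L Q)

/-- The sums `∑ k ∈ A, Q k` of pairwise orthogonal order projections form a bounded finitely
additive operator-valued set function. -/
lemma IsSigmaDedekindComplete.exists_additive_orderProjection (hX : IsSigmaDedekindComplete X)
    {Q : ℕ → X →L[ℝ] X} (hQ : ∀ k, IsOrderProjection (Q k))
    (horth : ∀ j k, j ≠ k → ∀ x, Q j (Q k x) = 0) :
    ∃ P : Set ℕ → X →L[ℝ] X, (∀ A B, Disjoint A B → P (A ∪ B) = P A + P B) ∧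
      (∀ k, P {k} = Q k) ∧ ∀ A x, ‖P A x‖ ≤ ‖x‖ := by
  classical
  let G : Set ℕ → ℕ → X → X := fun A n x => ∑ k ∈ Finset.range n, if k ∈ A then Q k x else 0
  have hterm : ∀ (A : Set ℕ) k x, 0 ≤ x → 0 ≤ if k ∈ A then Q k x else 0 := by
    intro A k x hx
    split_ifs
    · exact (hQ k).nonneg x hx
    · exact le_rfl
  have hmono : ∀ A x, 0 ≤ x → Monotone fun n => G A n x := fun A x hx =>
    monotone_nat_of_le_succ fun n => by
      simp only [G, Finset.sum_range_succ]
      exact le_add_of_nonneg_right (hterm A n x hx)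
  have hzero : ∀ A n k, n ≤ k → ∀ x, Q k (G A n x) = 0 := by
    intro A n k hnk x
    simp only [G, map_sum]
    refine Finset.sum_eq_zero fun j hj => ?_
    split_ifs
    · exact horth k j (by
        have := Finset.mem_range.1 hj
        lia) x
    · exact map_zero _
  have h0 : ∀ A n x, 0 ≤ x → 0 ≤ G A n x := fun A n x hx =>
    Finset.sum_nonneg fun k _ => hterm A k x hx
  have h1 : ∀ A n x, 0 ≤ x → G A n x ≤ x := by
    intro A n x hx
    induction n with
    | zero => simpa [G] using hx
    | succ n ih =>
      have hs : G A (n + 1) x = G A n x + if n ∈ A then Q n x else 0 :=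
        Finset.sum_range_succ _ _
      rw [hs]
      split_ifs
      · have h := (hQ n).le_self (x - G A n x) (sub_nonneg.2 ih)
        rw [map_sub, hzero A n n le_rfl x, sub_zero] at h
        rwa [← le_sub_iff_add_le']
      · simpa using ih
  have hadd : ∀ A n x y, G A n (x + y) = G A n x + G A n y := by
    intro A n x y
    simp only [G, ← Finset.sum_add_distrib]
    refine Finset.sum_congr rfl fun k _ => ?_
    split_ifs <;> simp
  choose P hP using fun A => hX.exists_clm_isLUB (G := G A) (h0 A) (h1 A) (hmono A)
    (fun n x y _ _ => (hadd A n x y).le) (fun n x y _ _ => ⟨n, (hadd A n x y).ge⟩)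
  refine ⟨P, fun A B hAB => clm_ext_of_nonneg fun x hx => ?_,
    fun k => clm_ext_of_nonneg fun x hx => ?_, fun A x => ?_⟩
  · refine (hP (A ∪ B) x hx).unique ?_
    have := (hP A x hx).range_add (hmono A x hx) (hmono B x hx) (hP B x hx)
    rw [add_apply]
    convert this using 3 with n
    simp only [G, ← Finset.sum_add_distrib]
    refine Finset.sum_congr rfl fun k _ => ?_
    by_cases hA : k ∈ A
    · have hB : k ∉ B := Set.disjoint_left.1 hAB hA
      simp [hA, hB]
    · simp [hA]
  · refine (hP {k} x hx).unique ⟨?_, fun c hc => ?_⟩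
    · rintro _ ⟨n, rfl⟩
      simp only [G, Set.mem_singleton_iff, Finset.sum_ite_eq', Finset.mem_range]
      split_ifs
      · exact le_rfl
      · exact (hQ k).nonneg x hx
    · have := hc ⟨k + 1, rfl⟩
      simpa [G] using this
  · have hp0 : ∀ x, 0 ≤ x → 0 ≤ P A x := fun x hx => (h0 A 0 x hx).trans ((hP A x hx).1 ⟨0, rfl⟩)
    refine norm_le_norm_of_abs_le_abs ?_
    exact abs_map_le_map_abs (P A).toLinearMap LinearMap.id
      (fun x hx => (hP A x hx).2 (by
        rintro _ ⟨n, rfl⟩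
        exact h1 A n x hx))
      (fun x hx => (neg_nonpos.2 (hp0 x hx)).trans hx) x

/-- Phillips' lemma for a sequence of orthogonal order projections. -/
lemma IsSigmaDedekindComplete.eventually_forall_abs_lt (hX : IsSigmaDedekindComplete X)
    {Q : ℕ → X →L[ℝ] X} (hQ : ∀ k, IsOrderProjection (Q k))
    (horth : ∀ j k, j ≠ k → ∀ x, Q j (Q k x) = 0) {f : ℕ → StrongDual ℝ X} {y : ℕ → X}
    (hlim : ∀ R : X →L[ℝ] X, Tendsto (fun n => f n (R (y n))) atTop (𝓝 0))
    {ε : ℝ} (hε : 0 < ε) : ∀ᶠ n in atTop, ∀ k, |f n (Q k (y n))| < ε := by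
  obtain ⟨P, hPadd, hPk, hPn⟩ := hX.exists_additive_orderProjection hQ horth
  have := eventually_forall_abs_singleton_lt (ν := fun n A => f n (P A (y n)))
    (fun n A B hAB => by simp [hPadd A B hAB])
    (fun n => ⟨‖f n‖ * ‖y n‖, fun A => by
      rw [← Real.norm_eq_abs]
      exact ((f n).le_opNorm _).trans (mul_le_mul_of_nonneg_left (hPn A _) (norm_nonneg _))⟩)
    (fun A => hlim (P A)) hε
  simpa only [hPk] using this

/-- Orthogonal order projections map a subsequence of an almost limited weakly null sequence,
term by term, to such a sequence. -/
lemma IsAlmostLimitedWeaklyNull.disjoint_subseq (hX : IsSigmaDedekindComplete X) {x : ℕ → X}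
    (hx : IsAlmostLimitedWeaklyNull x) {Q : ℕ → X →L[ℝ] X} (hQ : ∀ k, IsOrderProjection (Q k))
    (horth : ∀ j k, j ≠ k → ∀ x, Q j (Q k x) = 0) {m : ℕ → ℕ} (hm : StrictMono m) :
    IsAlmostLimitedWeaklyNull fun k => Q k (x (m k)) where
  isAlmostLimited := by
    have h := hx.isAlmostLimited
    rw [isAlmostLimited_range_iff] at h ⊢
    refine ⟨h.1.imp fun C hC n => ((hQ n).norm_apply_le _).trans (hC _), fun f hf hlim ε hε => ?_⟩
    by_contra hcon
    rw [not_eventually] at hcon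
    have hch : ∀ n, ∃ k, (∃ k, ε ≤ |f n (Q k (x (m k)))|) → ε ≤ |f n (Q k (x (m k)))| := by
      intro n
      by_cases hn : ∃ k, ε ≤ |f n (Q k (x (m k)))|
      · exact hn.imp fun k hk _ => hk
      · exact ⟨0, fun h => absurd h hn⟩
    choose κ hκ using hch
    -- The functionals `f n ∘ Q (κ n)` are still disjoint, and weak* null by Phillips' lemma.
    have hg := h.2 (fun n => f n ∘L Q (κ n))
      (fun i j hij => (hf hij).comp_orderProjection (hQ _) (hQ _)) (fun y => by
        rw [Metric.tendsto_atTop']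
        intro δ hδ
        obtain ⟨N, hN⟩ := eventually_atTop.1
          (hX.eventually_forall_abs_lt hQ horth (f := f) (y := fun _ => y)
            (fun R => hlim (R y)) hδ)
        refine ⟨N, fun n hn => ?_⟩
        rw [dist_zero_right, Real.norm_eq_abs]
        exact hN n hn.le (κ n)) ε hε
    obtain ⟨n, hn, hn2⟩ := (hcon.and_eventually hg).exists
    push Not at hn
    exact absurd (hκ n hn) (not_le.2 (hn2 (m (κ n))))
  tendsto_dual φ := by
    rw [Metric.tendsto_atTop']
    intro δ hδ
    obtain ⟨N, hN⟩ := eventually_atTop.1 (hm.tendsto_atTop.eventually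
      (hX.eventually_forall_abs_lt hQ horth (f := fun _ => φ) (y := x)
        (fun R => hx.tendsto_dual (φ ∘L R)) hδ))
    refine ⟨N, fun n hn => ?_⟩
    rw [dist_zero_right, Real.norm_eq_abs]
    exact hN n hn.le n

end TestSequence

/-! ### Truncation of almost limited weakly null sequences -/

section Truncation

variable {X : Type*} [NormedAddCommGroup X] [NormedSpace ℝ X] [Lattice X]
  [IsOrderedAddMonoid X]

/-- Projections onto the bands generated by disjoint elements are orthogonal. -/
lemma IsOrderProjection.comp_eq_zero {Q R : X →L[ℝ] X} (hQ : IsOrderProjection Q)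
    (hR : IsOrderProjection R) {v w : X} (hw : 0 ≤ w) (hvw : v ⊓ w = 0)
    (hQv : ∀ z, 0 ≤ z → z ⊓ v = 0 → Q z = 0) (hRw : ∀ z, 0 ≤ z → z ⊓ w = 0 → R z = 0) (x : X) :
    Q (R x) = 0 := by
  have hpos : ∀ x, 0 ≤ x → Q (R x) = 0 := by
    intro x hx
    have hRx := hR.nonneg x hx
    have hy := hQ.nonneg _ hRx
    have hRy : R (Q (R x)) = Q (R x) :=
      hR.apply_eq_self_of_le hy (hQ.le_self _ hRx) (hR.idem x)
    have hyw : 0 ≤ Q (R x) ⊓ w := le_inf hy hw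
    have hfix : Q (Q (R x) ⊓ w) = Q (R x) ⊓ w :=
      hQ.apply_eq_self_of_le hyw inf_le_left (hQ.idem _)
    have hzero : Q (R x) ⊓ w = 0 := by
      refine le_antisymm ?_ hyw
      rw [← hfix, ← hQv w hw (by rwa [inf_comm])]
      exact map_mono_of_nonneg (U := Q.toLinearMap) hQ.nonneg inf_le_right
    rw [← hRy]
    exact hRw _ hy hzero
  rw [← posPart_sub_negPart x, map_sub, map_sub, hpos _ (posPart_nonneg x),
    hpos _ (negPart_nonneg x), sub_zero]

variable [HasSolidNorm X] [IsOrderedModule ℝ X] [CompleteSpace X]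

/-- Up to `ε` in the seminorm `‖T |·|‖`, the positive parts of an almost limited weakly null
sequence are order bounded. Otherwise, the sequence would have a subsequence whose excess over
the multiples of the preceding terms is disjoint and large; this excess is dominated by an
almost limited weakly null sequence, which `T` maps to a norm null sequence. -/
lemma IsAlmostLimitedWeaklyNull.exists_eventually_norm_map_posPart_sub_le
    {Y : Type*} [NormedAddCommGroup Y] [NormedSpace ℝ Y] [Lattice Y] [IsOrderedAddMonoid Y]
    [HasSolidNorm Y] (hX : IsSigmaDedekindComplete X) {T : X →L[ℝ] Y}
    (hTpos : ∀ x, 0 ≤ x → 0 ≤ T x)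
    (hT : ∀ x, IsAlmostLimitedWeaklyNull x → Tendsto (fun n => T (x n)) atTop (𝓝 0))
    {x : ℕ → X} (hx : IsAlmostLimitedWeaklyNull x) {ε : ℝ} (hε : 0 < ε) :
    ∃ u, 0 ≤ u ∧ ∀ᶠ n in atTop, ‖T (x n - u)⁺‖ ≤ ε := by
  by_contra! hcon
  -- `u N` outweighs by a factor `4 ^ N` every term of index at most `N`, whichever of them the
  -- subsequence will use; so the next index depends only on the current one.
  let u : ℕ → X := fun N => (4 : ℝ) ^ N • ∑ i ∈ Finset.range (N + 1), |x i|
  have hu : ∀ N, 0 ≤ u N := fun N =>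
    smul_nonneg (by positivity) (Finset.sum_nonneg fun i _ => abs_nonneg _)
  have hule : ∀ N i, i ≤ N → (4 : ℝ) ^ N • |x i| ≤ u N := fun N i hi =>
    smul_le_smul_of_nonneg_left
      (Finset.single_le_sum (f := fun i => |x i|) (fun i _ => abs_nonneg _)
        (Finset.mem_range.2 (Nat.lt_succ_of_le hi))) (by positivity)
  have hch : ∀ N, ∃ n, N < n ∧ ε < ‖T (x n - u N)⁺‖ := by
    intro N
    obtain ⟨n, hn1, hn2⟩ := ((hcon (u N) (hu N)).and_eventually (eventually_gt_atTop N)).exists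
    exact ⟨n, hn2, hn1⟩
  choose g hg1 hg2 using hch
  let m : ℕ → ℕ := fun k => g^[k] 0
  have hmsucc : ∀ k, m (k + 1) = g (m k) := fun k => Function.iterate_succ_apply' g k 0
  have hm : StrictMono m := strictMono_nat_of_lt_succ fun k => by
    rw [hmsucc]
    exact hg1 _
  obtain ⟨C, hC⟩ := (isAlmostLimited_range_iff.1 hx.isAlmostLimited).1
  have hsum : Summable fun k => (1 / 2 : ℝ) ^ k • |x (m k)| := by
    refine Summable.of_norm_bounded (g := fun k => (1 / 2 : ℝ) ^ k * C)
      (summable_geometric_two.mul_right C) fun k => ?_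
    rw [norm_smul, norm_abs_eq_norm, Real.norm_of_nonneg (by positivity)]
    exact mul_le_mul_of_nonneg_left (hC _) (by positivity)
  have hterm : ∀ k, 0 ≤ (1 / 2 : ℝ) ^ k • |x (m k)| := fun k =>
    smul_nonneg (by positivity) (abs_nonneg _)
  obtain ⟨b, hb⟩ : ∃ b, b = ∑' k, (1 / 2 : ℝ) ^ k • |x (m k)| := ⟨_, rfl⟩
  have hble : ∀ k, (1 / 2 : ℝ) ^ k • |x (m k)| ≤ b := fun k => by
    rw [hb]
    exact hsum.le_tsum k fun j _ => hterm j
  have hb0 : 0 ≤ b := (hterm 0).trans (hble 0)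
  let y : ℕ → X := fun k => x (m (k + 1))
  -- Subtracting the small multiple of `b` as well makes the excesses disjoint.
  let v : ℕ → X := fun k => (y k - u (m k) - (1 / 2 : ℝ) ^ k • b)⁺
  have hv0 : ∀ k, 0 ≤ v k := fun k => posPart_nonneg _
  have hb2 : ∀ k, 0 ≤ (1 / 2 : ℝ) ^ k • b := fun k => smul_nonneg (by positivity) hb0
  have hvy : ∀ k, v k ≤ (y k)⁺ := fun k =>
    posPart_mono ((sub_le_self _ (hb2 k)).trans (sub_le_self _ (hu _)))
  have hdisj : ∀ j k, j < k → v j ⊓ v k = 0 := by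
    intro j k hjk
    -- `v j` and `v k` lie below the positive and the negative part of the same element `d`.
    let d : X := (4 : ℝ) ^ k • |y j| - |y k|
    have h1 : v k ≤ d⁻ := by
      have : y k - u (m k) - (1 / 2 : ℝ) ^ k • b ≤ -d := by
        have e1 : (4 : ℝ) ^ k • |y j| ≤ u (m k) :=
          (smul_le_smul_of_nonneg_right
            (pow_le_pow_right₀ (by norm_num) (hm.id_le k)) (abs_nonneg _)).trans
            (hule (m k) (m (j + 1)) (hm.monotone hjk))
        rw [neg_sub]
        exact (sub_le_self _ (hb2 k)).trans (sub_le_sub (le_abs_self _) e1)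
      exact sup_le (this.trans (neg_le_negPart d)) (negPart_nonneg d)
    have h2 : v j ≤ d⁺ := by
      have : y j - u (m j) - (1 / 2 : ℝ) ^ j • b ≤ ((1 / 4 : ℝ) ^ k) • d := by
        have e1 : (1 / 4 : ℝ) ^ k • |y k| ≤ (1 / 2 : ℝ) ^ j • b := by
          refine le_trans ?_ (smul_le_smul_of_nonneg_left (hble (k + 1)) (by positivity))
          rw [smul_smul, ← pow_add]
          refine smul_le_smul_of_nonneg_right ?_ (abs_nonneg _)
          rw [show (1 / 4 : ℝ) = (1 / 2) ^ 2 by norm_num, ← pow_mul]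
          exact pow_le_pow_of_le_one (by norm_num) (by norm_num) (by lia)
        have e2 : (1 / 4 : ℝ) ^ k • d = |y j| - (1 / 4 : ℝ) ^ k • |y k| := by
          rw [smul_sub, smul_smul, ← mul_pow]
          norm_num
        rw [e2]
        exact sub_le_sub ((sub_le_self _ (hu _)).trans (le_abs_self _)) e1
      refine sup_le (this.trans ?_) (posPart_nonneg d)
      calc (1 / 4 : ℝ) ^ k • d ≤ (1 / 4 : ℝ) ^ k • d⁺ :=
            smul_le_smul_of_nonneg_left (le_posPart d) (by positivity)
        _ ≤ (1 : ℝ) • d⁺ := smul_le_smul_of_nonneg_right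
            (pow_le_one₀ (by norm_num) (by norm_num)) (posPart_nonneg d)
        _ = d⁺ := one_smul _ _
    refine le_antisymm ?_ (le_inf (hv0 j) (hv0 k))
    rw [← posPart_inf_negPart_eq_zero d]
    exact inf_le_inf h2 h1
  choose Q hQ hQv hQz using fun k => hX.exists_orderProjection (hv0 k)
  have horth : ∀ j k, j ≠ k → ∀ x, Q j (Q k x) = 0 := fun j k hjk =>
    (hQ j).comp_eq_zero (hQ k) (hv0 k) (by
      rcases lt_or_gt_of_ne hjk with h | h
      · exact hdisj j k h
      · rw [inf_comm]
        exact hdisj k j h) (hQz j) (hQz k)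
  have hz := hT _ (hx.disjoint_subseq hX hQ horth (m := fun k => m (k + 1))
    fun i j hij => hm (Nat.succ_lt_succ hij))
  -- `Q k` kills the negative part of `y k`, so no modulus is needed here.
  have hvz : ∀ k, v k ≤ Q k (y k) := by
    intro k
    have hneg : Q k (y k)⁻ = 0 := hQz k _ (negPart_nonneg _) (by
      refine le_antisymm ?_ (le_inf (negPart_nonneg _) (hv0 k))
      rw [← posPart_inf_negPart_eq_zero (y k), inf_comm]
      exact inf_le_inf_right _ (hvy k))
    rw [← posPart_sub_negPart (y k), map_sub, hneg, sub_zero]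
    calc v k = Q k (v k) := (hQv k).symm
      _ ≤ Q k (y k)⁺ := map_mono_of_nonneg (U := (Q k).toLinearMap) (hQ k).nonneg (hvy k)
  have hlarge : ∀ k, ε < ‖T (Q k (y k)) + (1 / 2 : ℝ) ^ k • T b‖ := by
    intro k
    have h1 := hg2 (m k)
    rw [← hmsucc] at h1
    refine h1.trans_le (norm_le_norm_of_nonneg_of_le (hTpos _ (posPart_nonneg _)) ?_)
    rw [← map_smul, ← map_add]
    refine map_mono_of_nonneg (U := T.toLinearMap) hTpos (le_trans ?_ (add_le_add_left (hvz k) _))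
    refine sup_le ?_ (add_nonneg (hv0 k) (hb2 k))
    rw [← sub_le_iff_le_add]
    exact le_posPart _
  have hlim : Tendsto (fun k => ‖T (Q k (y k)) + (1 / 2 : ℝ) ^ k • T b‖) atTop (𝓝 0) := by
    have h1 : Tendsto (fun k : ℕ => (1 / 2 : ℝ) ^ k • T b) atTop (𝓝 ((0 : ℝ) • T b)) :=
      (tendsto_pow_atTop_nhds_zero_of_lt_one (by norm_num) (by norm_num)).smul_const _
    have := (hz.add h1).norm
    simpa using this
  obtain ⟨k, hk⟩ := (hlim.eventually (gt_mem_nhds hε)).exists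
  exact absurd (hlarge k) (not_lt.2 hk.le)

end Truncation

/-! ### Order continuous norms -/

lemma posPart_smul_of_pos {Y : Type*} [NormedAddCommGroup Y] [NormedSpace ℝ Y] [Lattice Y]
    [IsOrderedModule ℝ Y] {c : ℝ} (hc : 0 < c) (x : Y) : (c • x)⁺ = c • x⁺ := by
  refine le_antisymm (sup_le (smul_le_smul_of_nonneg_left (le_posPart x) hc.le)
    (smul_nonneg hc.le (posPart_nonneg x))) ?_
  have h : x⁺ ≤ c⁻¹ • (c • x)⁺ := by
    refine sup_le ?_ (smul_nonneg (inv_nonneg.2 hc.le) (posPart_nonneg _))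
    have := smul_le_smul_of_nonneg_left (le_posPart (c • x)) (inv_nonneg.2 hc.le)
    rwa [inv_smul_smul₀ hc.ne'] at this
  have := smul_le_smul_of_nonneg_left h hc.le
  rwa [smul_inv_smul₀ hc.ne'] at this

section OrderContinuousNorm

variable {Y : Type*} [NormedAddCommGroup Y] [NormedSpace ℝ Y] [Lattice Y] [HasSolidNorm Y]
  [IsOrderedAddMonoid Y] [IsOrderedModule ℝ Y]

lemma nonpos_of_forall_nsmul_le {c a : Y} (h : ∀ k : ℕ, k • c ≤ a) : c ≤ 0 := by
  have hlim : Tendsto (fun k : ℕ => (1 / ((k : ℝ) + 1)) • a) atTop (𝓝 ((0 : ℝ) • a)) :=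
    tendsto_one_div_add_atTop_nhds_zero_nat.smul_const a
  rw [zero_smul] at hlim
  refine ge_of_tendsto' hlim fun k => ?_
  have h1 := smul_le_smul_of_nonneg_left (h (k + 1))
    (by positivity : (0 : ℝ) ≤ 1 / ((k : ℝ) + 1))
  rw [← Nat.cast_smul_eq_nsmul ℝ, smul_smul] at h1
  have h2 : 1 / ((k : ℝ) + 1) * ((k + 1 : ℕ) : ℝ) = 1 := by
    push_cast
    field_simp
  rwa [h2, one_smul] at h1

/-- The differences between the upper bounds and the terms of an increasing order bounded sequence
decrease to zero, by the Archimedean property. -/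
lemma HasOrderContinuousNorm.cauchySeq (hY : HasOrderContinuousNorm Y)
    {x : ℕ → Y} (hx : Monotone x) {w : Y} (hw : ∀ n, x n ≤ w) : CauchySeq x := by
  let U : Set Y := {v | ∀ n, x n ≤ v}
  let val : (↥U)ᵒᵈ → Y := fun v => (OrderDual.ofDual v : ↥U).1
  have hval : ∀ (v : (↥U)ᵒᵈ) n, x n ≤ val v := fun v => (OrderDual.ofDual v : ↥U).2
  let D : (↥U)ᵒᵈ × ℕ → Y := fun p => val p.1 - x p.2
  have : Nonempty ((↥U)ᵒᵈ × ℕ) := ⟨(OrderDual.toDual ⟨w, hw⟩, 0)⟩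
  have : IsDirectedOrder ((↥U)ᵒᵈ × ℕ) := ⟨fun p q =>
    ⟨(OrderDual.toDual ⟨val p.1 ⊓ val q.1, fun n => le_inf (hval _ n) (hval _ n)⟩, max p.2 q.2),
      ⟨(inf_le_left : val p.1 ⊓ val q.1 ≤ _), le_max_left _ _⟩,
      ⟨(inf_le_right : val p.1 ⊓ val q.1 ≤ _), le_max_right _ _⟩⟩⟩
  have hanti : Antitone D := fun p q hpq =>
    sub_le_sub (show val q.1 ≤ val p.1 from hpq.1) (hx hpq.2)
  have hglb : IsGLB (Set.range D) 0 := by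
    refine ⟨?_, fun c hc => ?_⟩
    · rintro _ ⟨p, rfl⟩
      exact sub_nonneg.2 (hval _ _)
    · have hstep : ∀ v ∈ U, ∀ n, c ≤ v - x n := fun v hv n =>
        hc ⟨(OrderDual.toDual ⟨v, hv⟩, n), rfl⟩
      have hk : ∀ k : ℕ, w - k • c ∈ U := by
        intro k
        induction k with
        | zero => simpa [U] using hw
        | succ k ih =>
          intro n
          have := hstep _ ih n
          rw [le_sub_comm] at this
          rwa [succ_nsmul, ← sub_sub]
      exact nonpos_of_forall_nsmul_le fun k => le_sub_comm.1 (hk k 0)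
  have hlim := hY _ D hanti hglb
  rw [Metric.cauchySeq_iff']
  intro ε hε
  obtain ⟨⟨v, N⟩, hv⟩ := (hlim.eventually (gt_mem_nhds hε)).exists
  refine ⟨N, fun n hn => ?_⟩
  rw [dist_eq_norm]
  exact (norm_le_norm_of_nonneg_of_le (sub_nonneg.2 (hx hn))
    (sub_le_sub_right (hval v n) _)).trans_lt hv

lemma HasOrderContinuousNorm.isSigmaDedekindComplete [CompleteSpace Y]
    (hY : HasOrderContinuousNorm Y) : IsSigmaDedekindComplete Y := by
  rintro s hs hsc ⟨w, hw⟩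
  obtain ⟨f, rfl⟩ := hsc.exists_eq_range hs
  obtain ⟨a, ha⟩ := cauchySeq_tendsto_of_complete
    (hY.cauchySeq (partialSups_monotone f) (w := w)
      fun n => partialSups_le f n w fun i _ => hw ⟨i, rfl⟩)
  refine ⟨a, ?_, fun c hc => ?_⟩
  · rintro _ ⟨n, rfl⟩
    exact (le_partialSups f n).trans ((partialSups_monotone f).ge_of_tendsto ha n)
  · exact le_of_tendsto' ha fun n => partialSups_le f n c fun i _ => hc ⟨i, rfl⟩

/-- Positive elements are normed by positive functionals: apply the Hahn–Banach theorem with the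
sublinear functional `x ↦ ‖x⁺‖`. -/
lemma exists_nonneg_dual_apply_eq_norm {y : Y} (hy : 0 ≤ y) :
    ∃ φ : StrongDual ℝ Y, (∀ x, 0 ≤ x → 0 ≤ φ x) ∧ ‖φ‖ ≤ 1 ∧ φ y = ‖y‖ := by
  rcases eq_or_ne y 0 with rfl | hy0
  · exact ⟨0, by simp, by simp, by simp⟩
  have hpn : ∀ x : Y, ‖x⁺‖ ≤ ‖x‖ := fun x => by
    rw [← norm_abs_eq_norm x]
    exact norm_le_norm_of_nonneg_of_le (posPart_nonneg x) (sup_le (le_abs_self x) (abs_nonneg x))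
  obtain ⟨g, hg1, hg2⟩ := exists_extension_of_le_sublinear
    (LinearPMap.mkSpanSingleton (K := ℝ) y ‖y‖ hy0) (fun x => ‖x⁺‖)
    (fun c hc x => by
      rw [posPart_smul_of_pos hc, norm_smul, Real.norm_of_nonneg hc.le])
    (fun x z => by
      refine (norm_le_norm_of_nonneg_of_le (posPart_nonneg _) ?_).trans (norm_add_le _ _)
      exact sup_le (add_le_add (le_posPart _) (le_posPart _))
        (add_nonneg (posPart_nonneg _) (posPart_nonneg _)))
    (by
      rintro ⟨x, hx⟩
      obtain ⟨c, rfl⟩ := Submodule.mem_span_singleton.1 hx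
      have := LinearPMap.mkSpanSingleton'_apply (R := ℝ) y ‖y‖
        (fun c hc => by simp [(smul_eq_zero.1 hc).resolve_right hy0]) c hx
      refine this.le.trans ?_
      rcases le_or_gt c 0 with hc | hc
      · exact (mul_nonpos_of_nonpos_of_nonneg hc (norm_nonneg _)).trans (norm_nonneg _)
      · rw [posPart_smul_of_pos hc, posPart_of_nonneg hy, norm_smul, Real.norm_of_nonneg hc.le]
        rfl)
  have hbound : ∀ x, ‖g x‖ ≤ 1 * ‖x‖ := fun x => by
    rw [one_mul, Real.norm_eq_abs]
    refine abs_le'.2 ⟨(hg2 x).trans (hpn x), ?_⟩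
    rw [← map_neg, ← norm_neg x]
    exact (hg2 _).trans (hpn _)
  refine ⟨g.mkContinuous 1 hbound, fun x hx => ?_, g.mkContinuous_norm_le zero_le_one _, ?_⟩
  · have := hg2 (-x)
    rw [posPart_of_nonpos (neg_nonpos.2 hx), norm_zero, map_neg] at this
    simpa using this
  · have := hg1 ⟨y, Submodule.mem_span_singleton_self y⟩
    rw [LinearPMap.mkSpanSingleton_apply] at this
    exact this

/-- On order intervals, smallness in norm can be tested by a single positive functional. Otherwise
there are `y k` in `[0, w]` and positive functionals `φ k` in the unit ball with `φ k (y k)` large,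
but `φ k` small on the supremum of the later terms. Then the suprema of the tails, which decrease,
are not a Cauchy sequence. -/
lemma HasOrderContinuousNorm.exists_dual_norm_le [CompleteSpace Y] (hY : HasOrderContinuousNorm Y)
    (w : Y) {ε : ℝ} (hε : 0 < ε) :
    ∃ φ : StrongDual ℝ Y, (∀ x, 0 ≤ x → 0 ≤ φ x) ∧
      ∃ δ > 0, ∀ y, 0 ≤ y → y ≤ w → φ y < δ → ‖y‖ ≤ ε := by
  classical
  by_contra! hcon
  obtain ⟨p, hp, hpp⟩ := exists_seq_of_forall_finset_exists
    (fun p : ℕ × Y × StrongDual ℝ Y => 0 ≤ p.2.1 ∧ p.2.1 ≤ w ∧ (∀ x, 0 ≤ x → 0 ≤ p.2.2 x) ∧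
      ‖p.2.2‖ ≤ 1 ∧ ε < p.2.2 p.2.1)
    (fun p q => p.1 < q.1 ∧ p.2.2 q.2.1 ≤ ε / 4 * (1 / 2) ^ q.1) (by
      intro s hs
      have hφ : ∀ x, 0 ≤ x → ∀ p ∈ s, 0 ≤ p.2.2 x := fun x hx p hp => (hs p hp).2.2.1 x hx
      obtain ⟨y, hy0, hyw, hys, hyn⟩ := hcon (∑ p ∈ s, p.2.2)
        (fun x hx => by
          rw [sum_apply]
          exact Finset.sum_nonneg (hφ x hx))
        (ε / 4 * (1 / 2) ^ (s.sup Prod.fst + 1)) (by positivity)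
      obtain ⟨φ, hφ0, hφ1, hφy⟩ := exists_nonneg_dual_apply_eq_norm hy0
      refine ⟨(s.sup Prod.fst + 1, y, φ), ⟨hy0, hyw, hφ0, hφ1, by rwa [hφy]⟩, fun q hq =>
        ⟨Nat.lt_succ_of_le (Finset.le_sup (f := Prod.fst) hq), le_trans ?_ hys.le⟩⟩
      rw [sum_apply]
      exact Finset.single_le_sum (f := fun p : ℕ × Y × StrongDual ℝ Y => p.2.2 y) (hφ y hy0) hq)
  have hidx : StrictMono fun k => (p k).1 := fun i j hij => (hpp i j hij).1
  let y : ℕ → Y := fun k => (p k).2.1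
  let φ : ℕ → StrongDual ℝ Y := fun k => (p k).2.2
  have hy0 : ∀ k, 0 ≤ y k := fun k => (hp k).1
  have hφ0 : ∀ k x, 0 ≤ x → 0 ≤ φ k x := fun k => (hp k).2.2.1
  have hsmall : ∀ j k, j < k → φ j (y k) ≤ ε / 4 * (1 / 2) ^ k := fun j k hjk =>
    (hpp j k hjk).2.trans (mul_le_mul_of_nonneg_left
      (pow_le_pow_of_le_one (by norm_num) (by norm_num) (hidx.id_le k)) (by positivity))
  let t : ℕ → ℕ → Y := fun k n => partialSups (fun i => y (k + i)) n
  have htmono : ∀ k, Monotone (t k) := fun k => partialSups_monotone _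
  have hex : ∀ k, ∃ a, Tendsto (t k) atTop (𝓝 a) := fun k =>
    cauchySeq_tendsto_of_complete (hY.cauchySeq (htmono k) (w := w)
      fun n => partialSups_le _ n w fun i _ => (hp (k + i)).2.1)
  choose s hs using hex
  have hle : ∀ k i, y (k + i) ≤ s k := fun k i =>
    (le_partialSups (fun i => y (k + i)) i).trans ((htmono k).ge_of_tendsto (hs k) i)
  have hanti : ∀ k, s (k + 1) ≤ s k := fun k => le_of_tendsto' (hs (k + 1)) fun n =>
    partialSups_le _ n _ fun i _ => by
      have := hle k (1 + i)
      rwa [← add_assoc] at this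
  have hs0 : ∀ k, 0 ≤ s k := fun k => (hy0 (k + 0)).trans (hle k 0)
  have htail : ∀ k, φ k (s (k + 1)) ≤ ε / 2 := by
    intro k
    refine le_of_tendsto' (((φ k).continuous.tendsto _).comp (hs (k + 1))) fun n => ?_
    have h1 : t (k + 1) n ≤ ∑ i ∈ Finset.range (n + 1), y (k + 1 + i) :=
      partialSups_le _ n _ fun i hi => Finset.single_le_sum (f := fun i => y (k + 1 + i))
        (fun i _ => hy0 _) (Finset.mem_range.2 (Nat.lt_succ_of_le hi))
    calc φ k (t (k + 1) n) ≤ φ k (∑ i ∈ Finset.range (n + 1), y (k + 1 + i)) := by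
          have := hφ0 k _ (sub_nonneg.2 h1)
          rw [map_sub] at this
          linarith
      _ = ∑ i ∈ Finset.range (n + 1), φ k (y (k + 1 + i)) := map_sum _ _ _
      _ ≤ ∑ i ∈ Finset.range (n + 1), ε / 4 * (1 / 2) ^ i :=
          Finset.sum_le_sum fun i _ => (hsmall k (k + 1 + i) (by lia)).trans
            (mul_le_mul_of_nonneg_left
              (pow_le_pow_of_le_one (by norm_num) (by norm_num) (by lia)) (by positivity))
      _ = ε / 4 * ∑ i ∈ Finset.range (n + 1), (1 / 2 : ℝ) ^ i := by rw [Finset.mul_sum]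
      _ ≤ ε / 4 * 2 := mul_le_mul_of_nonneg_left (sum_geometric_two_le _) (by positivity)
      _ = ε / 2 := by ring
  have hcauchy : CauchySeq fun k => -s k :=
    hY.cauchySeq (monotone_nat_of_le_succ fun k => neg_le_neg (hanti k)) (w := 0)
      fun k => neg_nonpos.2 (hs0 k)
  obtain ⟨N, hN⟩ := Metric.cauchySeq_iff.1 hcauchy (ε / 2) (half_pos hε)
  have h1 := hN (N + 1) (Nat.le_succ N) N le_rfl
  rw [dist_eq_norm, sub_neg_eq_add, neg_add_eq_sub] at h1
  have h2 : φ N (s N - s (N + 1)) ≤ ‖s N - s (N + 1)‖ :=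
    (le_abs_self _).trans (((φ N).le_opNorm _).trans
      (mul_le_of_le_one_left (norm_nonneg _) (hp N).2.2.2.1))
  have h3 : φ N (y N) ≤ φ N (s N) := by
    have := hφ0 N _ (sub_nonneg.2 (hle N 0))
    rw [map_sub, add_zero] at this
    linarith
  have h4 : ε < φ N (y N) := (hp N).2.2.2.2
  rw [map_sub] at h2
  linarith [htail N]

end OrderContinuousNorm

/-! ### Approximation of a dominated operator -/

/-- The loss of energy `∑ s²/t` when a finite family is merged controls the distance of `s` to the
multiple of `t` with the same total mass. -/
lemma sum_abs_sub_div_mul_le {κ : Type*} [Fintype κ] {s t : κ → ℝ} (hs : ∀ k, 0 ≤ s k)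
    (hst : ∀ k, s k ≤ t k) {η : ℝ} (hη : 0 < η) :
    ∑ k, |s k - (∑ l, s l) / (∑ l, t l) * t k| ≤
      (∑ k, s k ^ 2 / t k - (∑ l, s l) ^ 2 / ∑ l, t l) / (2 * η) + η / 2 * ∑ l, t l := by
  obtain ⟨A, hA⟩ : ∃ A, A = ∑ l, s l := ⟨_, rfl⟩
  obtain ⟨B, hB⟩ : ∃ B, B = ∑ l, t l := ⟨_, rfl⟩
  rw [← hA, ← hB]
  have hAB : B = 0 → A = 0 := fun h => by
    have h1 : A ≤ B := by
      rw [hA, hB]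
      exact Finset.sum_le_sum fun k _ => hst k
    have h2 : 0 ≤ A := by
      rw [hA]
      exact Finset.sum_nonneg fun k _ => hs k
    linarith
  have hterm : ∀ k, |s k - A / B * t k| ≤
      (s k ^ 2 / t k - 2 * (A / B) * s k + (A / B) ^ 2 * t k) / (2 * η) + η / 2 * t k := by
    intro k
    rcases (hs k).trans (hst k) |>.eq_or_lt with h | h
    · have : s k = 0 := le_antisymm ((hst k).trans h.ge) (hs k)
      simp [this, ← h]
    · have e : s k ^ 2 / t k - 2 * (A / B) * s k + (A / B) ^ 2 * t k =
          |s k - A / B * t k| ^ 2 / t k := by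
        rw [sq_abs]
        field_simp
        ring
      rw [e]
      have h2 : 0 ≤ (|s k - A / B * t k| - η * t k) ^ 2 / (2 * η * t k) := by positivity
      have h3 : (|s k - A / B * t k| - η * t k) ^ 2 / (2 * η * t k) =
          |s k - A / B * t k| ^ 2 / t k / (2 * η) + η / 2 * t k - |s k - A / B * t k| := by
        field_simp
        ring
      linarith
  refine (Finset.sum_le_sum fun k _ => hterm k).trans ?_
  rw [Finset.sum_add_distrib, ← Finset.sum_div, Finset.sum_add_distrib, Finset.sum_sub_distrib,
    ← Finset.mul_sum, ← Finset.mul_sum, ← Finset.mul_sum, ← hA, ← hB]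
  have e : -(2 * (A / B) * A) + (A / B) ^ 2 * B = -(A ^ 2 / B) := by
    by_cases h : B = 0
    · simp [hAB h]
    · field_simp
      ring
  have : ∑ k, s k ^ 2 / t k - 2 * (A / B) * A + (A / B) ^ 2 * B =
      ∑ k, s k ^ 2 / t k - A ^ 2 / B := by linarith
  rw [this]

/-- The component of `p + (1 - p) = 1` with the given label. -/
noncomputable def boolComponent {Z : Type*} [NormedAddCommGroup Z] [NormedSpace ℝ Z] (p : Z →L[ℝ] Z)
    (a : Bool) : Z →L[ℝ] Z :=
  cond a p (1 - p)

lemma sum_boolComponent {Z : Type*} [NormedAddCommGroup Z] [NormedSpace ℝ Z] (p : Z →L[ℝ] Z)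
    (z : Z) : ∑ a, boolComponent p a z = z := by
  simp [boolComponent]

lemma sum_bool_prod_boolComponent {X Y : Type*} [NormedAddCommGroup X] [NormedSpace ℝ X]
    [NormedAddCommGroup Y] [NormedSpace ℝ Y] (L : X →L[ℝ] Y) (p : Y →L[ℝ] Y) (q : X →L[ℝ] X)
    (P : Y →L[ℝ] Y) (Q : X →L[ℝ] X) (x : X) :
    ∑ k : Bool × Bool, boolComponent p k.1 (P (L (Q (boolComponent q k.2 x)))) = P (L (Q x)) := by
  rw [Fintype.sum_prod_type_right]
  simp only [sum_boolComponent]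
  rw [← map_sum, ← map_sum, ← map_sum, sum_boolComponent]

lemma abs_add_abs_self_le {Y : Type*} [AddCommGroup Y] [Lattice Y] [IsOrderedAddMonoid Y] {a : Y} :
    |a| + |a| ≤ |a + a| := by
  change (a ⊔ -a) + (a ⊔ -a) ≤ _
  rw [sup_add, add_sup, add_sup, add_neg_cancel, neg_add_cancel, ← neg_add]
  exact sup_le (sup_le (le_abs_self _) (abs_nonneg _)) (sup_le (abs_nonneg _) (neg_le_abs _))

section Approximation

variable {X : Type*} [NormedAddCommGroup X] [NormedSpace ℝ X] [Lattice X] [IsOrderedAddMonoid X]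
  {Y : Type*} [NormedAddCommGroup Y] [NormedSpace ℝ Y] [Lattice Y]

/-- Finite families of pairs of positive operators that decompose every operator `L` from `X` to `Y`
as `L = ∑ i, P i ∘ L ∘ Q i`, where all `Q i` preserve almost limited weakly null sequences. -/
structure IsOperatorPartition {ι : Type} [Fintype ι] (P : ι → Y →L[ℝ] Y) (Q : ι → X →L[ℝ] X) :
    Prop where
  left_nonneg : ∀ i y, 0 ≤ y → 0 ≤ P i y
  right_nonneg : ∀ i x, 0 ≤ x → 0 ≤ Q i x
  right_map : ∀ i x, IsAlmostLimitedWeaklyNull x → IsAlmostLimitedWeaklyNull fun n => Q i (x n)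
  sum_eq : ∀ (L : X →L[ℝ] Y) x, ∑ i, P i (L (Q i x)) = L x

/-- The energy `∑ φ(P i S Q i u)² / φ(P i T Q i u)` of an operator partition. Terms with vanishing
denominator have vanishing numerator if `0 ≤ S ≤ T`, so the convention for division by zero is the
right one. -/
noncomputable def partitionEnergy (S T : X →L[ℝ] Y) (φ : StrongDual ℝ Y) (u : X) {ι : Type}
    [Fintype ι] (P : ι → Y →L[ℝ] Y) (Q : ι → X →L[ℝ] X) : ℝ :=
  ∑ i, φ (P i (S (Q i u))) ^ 2 / φ (P i (T (Q i u)))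

lemma IsOperatorPartition.trivial :
    IsOperatorPartition (fun _ : Unit => (1 : Y →L[ℝ] Y)) (fun _ : Unit => (1 : X →L[ℝ] X)) where
  left_nonneg _ _ hy := hy
  right_nonneg _ _ hx := hx
  right_map _ _ hx := hx
  sum_eq L x := by simp

variable [IsOrderedAddMonoid Y]

lemma IsOrderProjection.boolComponent {p : Y →L[ℝ] Y} (hp : IsOrderProjection p) (a : Bool) :
    IsOrderProjection (boolComponent p a) := by
  cases a
  · exact hp.one_sub
  · exact hp

lemma IsOperatorPartition.refine [HasSolidNorm X] {ι : Type} [Fintype ι] {P : ι → Y →L[ℝ] Y}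
    {Q : ι → X →L[ℝ] X} (h : IsOperatorPartition P Q) {p : Y →L[ℝ] Y} (hp : IsOrderProjection p)
    {q : X →L[ℝ] X} (hq : IsOrderProjection q) :
    IsOperatorPartition (fun k : ι × Bool × Bool => boolComponent p k.2.1 ∘L P k.1)
      (fun k : ι × Bool × Bool => Q k.1 ∘L boolComponent q k.2.2) where
  left_nonneg k y hy := (hp.boolComponent _).nonneg _ (h.left_nonneg _ y hy)
  right_nonneg k x hx := h.right_nonneg _ _ ((hq.boolComponent _).nonneg x hx)
  right_map k x hx := h.right_map _ _ (hx.map_orderProjection (hq.boolComponent _))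
  sum_eq L x := by
    rw [Fintype.sum_prod_type]
    simp only [ContinuousLinearMap.comp_apply]
    simp only [sum_bool_prod_boolComponent]
    exact h.sum_eq L x

variable {S T : X →L[ℝ] Y} {φ : StrongDual ℝ Y} {u : X}

/-- A partition of nearly maximal energy. -/
lemma exists_isOperatorPartition_energy_le (hS : ∀ x, 0 ≤ x → 0 ≤ S x)
    (hST : ∀ x, 0 ≤ x → S x ≤ T x) (hφ : ∀ y, 0 ≤ y → 0 ≤ φ y) (hu : 0 ≤ u) {δ : ℝ}
    (hδ : 0 < δ) :
    ∃ (ι : Type) (_ : Fintype ι) (P : ι → Y →L[ℝ] Y) (Q : ι → X →L[ℝ] X),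
      IsOperatorPartition P Q ∧ ∀ (κ : Type) [Fintype κ] (P' : κ → Y →L[ℝ] Y) (Q' : κ → X →L[ℝ] X),
        IsOperatorPartition P' Q' →
        partitionEnergy S T φ u P' Q' ≤ partitionEnergy S T φ u P Q + δ := by
  let E : Set ℝ := {e | ∃ (ι : Type) (_ : Fintype ι) (P : ι → Y →L[ℝ] Y) (Q : ι → X →L[ℝ] X),
    IsOperatorPartition P Q ∧ e = partitionEnergy S T φ u P Q}
  have hne : E.Nonempty := ⟨_, Unit, inferInstance, _, _, IsOperatorPartition.trivial, rfl⟩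
  have hbdd : BddAbove E := by
    refine ⟨φ (T u), ?_⟩
    rintro _ ⟨ι, _, P, Q, h, rfl⟩
    rw [← h.sum_eq T u, map_sum]
    refine Finset.sum_le_sum fun i _ => ?_
    have h0 := hφ _ (h.left_nonneg i _ (hS _ (h.right_nonneg i u hu)))
    have h1 : φ (P i (S (Q i u))) ≤ φ (P i (T (Q i u))) := by
      have := hφ _ (h.left_nonneg i _ (sub_nonneg.2 (hST _ (h.right_nonneg i u hu))))
      rw [map_sub, map_sub] at this
      linarith
    refine div_le_of_le_mul₀ (h0.trans h1) (h0.trans h1) ?_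
    nlinarith
  obtain ⟨_, ⟨ι, hι, P, Q, h, rfl⟩, hlt⟩ :=
    exists_lt_of_lt_csSup hne (sub_lt_self (sSup E) hδ)
  refine ⟨ι, hι, P, Q, h, fun κ _ P' Q' h' => ?_⟩
  have := le_csSup hbdd ⟨κ, inferInstance, P', Q', h', rfl⟩
  linarith

variable [HasSolidNorm X] [HasSolidNorm Y]

/-- The `T`-average `R` of `S` along a partition of nearly maximal energy is close to `S` on the
components of `u`, because refining the partition by one projection on each side gains little
energy. -/
lemma exists_approx_on_components (hY : IsSigmaDedekindComplete Y)
    (hS : ∀ x, 0 ≤ x → 0 ≤ S x) (hST : ∀ x, 0 ≤ x → S x ≤ T x)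
    (hT : ∀ x, IsAlmostLimitedWeaklyNull x → Tendsto (fun n => T (x n)) atTop (𝓝 0))
    [IsOrderedModule ℝ Y]
    (hφ : ∀ y, 0 ≤ y → 0 ≤ φ y) (hu : 0 ≤ u) {ε : ℝ} (hε : 0 < ε) :
    ∃ R : X →L[ℝ] Y, (∀ x, 0 ≤ x → 0 ≤ R x) ∧ (∀ x, 0 ≤ x → R x ≤ T x) ∧
      (∀ x, IsAlmostLimitedWeaklyNull x → Tendsto (fun n => R (x n)) atTop (𝓝 0)) ∧
      ∀ q : X →L[ℝ] X, IsOrderProjection q → φ |(S - R) (q u)| ≤ ε := by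
  have hTu : 0 ≤ φ (T u) := hφ _ ((hS u hu).trans (hST u hu))
  -- The bound obtained at the end is `η / 2 * (1 + φ (T u))`.
  obtain ⟨η, hη⟩ : ∃ η, η = 2 * ε / (1 + φ (T u)) := ⟨_, rfl⟩
  have hη0 : 0 < η := by
    rw [hη]
    positivity
  obtain ⟨ι, _, P, Q, h, hmax⟩ :=
    exists_isOperatorPartition_energy_le hS hST hφ hu (δ := η ^ 2) (by positivity)
  have hTx : ∀ x, 0 ≤ x → 0 ≤ T x := fun x hx => (hS x hx).trans (hST x hx)
  have hmonoP : ∀ i x, 0 ≤ x → φ (P i (S (Q i x))) ≤ φ (P i (T (Q i x))) := by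
    intro i x hx
    have := hφ _ (h.left_nonneg i _ (sub_nonneg.2 (hST _ (h.right_nonneg i x hx))))
    rw [map_sub, map_sub] at this
    linarith
  let c : ι → ℝ := fun i => φ (P i (S (Q i u))) / φ (P i (T (Q i u)))
  have hc0 : ∀ i, 0 ≤ c i := fun i =>
    div_nonneg (hφ _ (h.left_nonneg i _ (hS _ (h.right_nonneg i u hu))))
      (hφ _ (h.left_nonneg i _ (hTx _ (h.right_nonneg i u hu))))
  have hc1 : ∀ i, c i ≤ 1 := fun i => div_le_one_of_le₀ (hmonoP i u hu)
    (hφ _ (h.left_nonneg i _ (hTx _ (h.right_nonneg i u hu))))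
  let R : X →L[ℝ] Y := ∑ i, c i • (P i ∘L T ∘L Q i)
  have hR : ∀ x, R x = ∑ i, c i • P i (T (Q i x)) := fun x => by
    simp [R, sum_apply]
  refine ⟨R, fun x hx => ?_, fun x hx => ?_, fun x hx => ?_, fun q hq => ?_⟩
  · rw [hR]
    exact Finset.sum_nonneg fun i _ =>
      smul_nonneg (hc0 i) (h.left_nonneg i _ (hTx _ (h.right_nonneg i x hx)))
  · rw [hR, ← h.sum_eq T x]
    refine Finset.sum_le_sum fun i _ => ?_
    have := smul_le_smul_of_nonneg_right (hc1 i)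
      (h.left_nonneg i _ (hTx _ (h.right_nonneg i x hx)))
    rwa [one_smul] at this
  · have : Tendsto (fun n => ∑ i, c i • P i (T (Q i (x n)))) atTop
        (𝓝 (∑ i, c i • P i 0)) := tendsto_finsetSum _ fun i _ =>
      (((P i).continuous.tendsto 0).comp (hT _ (h.right_map i x hx))).const_smul (c i)
    simpa [hR] using this
  · obtain ⟨y, hy⟩ : ∃ y, y = (S - R) (q u) := ⟨_, rfl⟩
    rw [← hy]
    obtain ⟨p, hp, hpv, hpz⟩ := hY.exists_orderProjection (posPart_nonneg y)
    have hpy : p y = y⁺ := by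
      conv_lhs => rw [← posPart_sub_negPart y]
      rw [map_sub, hpv, hpz _ (negPart_nonneg y) (by
        rw [inf_comm]
        exact posPart_inf_negPart_eq_zero y), sub_zero]
    have habs : φ |y| = φ (p y) - φ ((1 - p) y) := by
      rw [← map_sub]
      congr 1
      rw [sub_apply, one_apply_eq_self, hpy, ← posPart_add_negPart y]
      nth_rw 4 [← posPart_sub_negPart y]
      abel
    -- With `p y = y⁺`, refining by `{p, 1 - p}` and `{q, 1 - q}` makes `φ |y|` visible.
    let s : ι → Bool × Bool → ℝ := fun i k =>
      φ (boolComponent p k.1 (P i (S (Q i (boolComponent q k.2 u)))))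
    let t : ι → Bool × Bool → ℝ := fun i k =>
      φ (boolComponent p k.1 (P i (T (Q i (boolComponent q k.2 u)))))
    have href := h.refine hp hq
    have hs0 : ∀ i k, 0 ≤ s i k := fun i k =>
      hφ _ (href.left_nonneg (i, k) _ (hS _ (href.right_nonneg (i, k) u hu)))
    have hst : ∀ i k, s i k ≤ t i k := by
      intro i k
      have := hφ _ (href.left_nonneg (i, k) _
        (sub_nonneg.2 (hST _ (href.right_nonneg (i, k) u hu))))
      rw [map_sub, map_sub] at this
      exact sub_nonneg.1 this
    have hsum_s : ∀ i, ∑ k, s i k = φ (P i (S (Q i u))) := fun i => by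
      rw [← sum_bool_prod_boolComponent S p q, map_sum]
    have hsum_t : ∀ i, ∑ k, t i k = φ (P i (T (Q i u))) := fun i => by
      rw [← sum_bool_prod_boolComponent T p q, map_sum]
    have hcomp : ∀ a, φ (boolComponent p a y) = ∑ i, (s i (a, true) - c i * t i (a, true)) := by
      intro a
      rw [hy, sub_apply, hR, ← h.sum_eq S (q u), ← Finset.sum_sub_distrib, map_sum, map_sum]
      refine Finset.sum_congr rfl fun i _ => ?_
      rw [map_sub, map_sub, map_smul, map_smul, smul_eq_mul]
      rfl
    have hle : φ |y| ≤ ∑ i, ∑ k, |s i k - c i * t i k| := by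
      rw [habs]
      have e1 : φ (p y) = _ := hcomp true
      have e2 : φ ((1 - p) y) = _ := hcomp false
      rw [e1, e2, ← Finset.sum_sub_distrib]
      refine Finset.sum_le_sum fun i _ => ?_
      rw [Fintype.sum_prod_type]
      simp only [Fintype.sum_bool]
      have h1 := le_abs_self (s i (true, true) - c i * t i (true, true))
      have h2 := neg_le_abs (s i (false, true) - c i * t i (false, true))
      have h3 := abs_nonneg (s i (true, false) - c i * t i (true, false))
      have h4 := abs_nonneg (s i (false, false) - c i * t i (false, false))
      linarith
    have hbound : ∀ i, ∑ k, |s i k - c i * t i k| ≤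
        (∑ k, s i k ^ 2 / t i k - φ (P i (S (Q i u))) ^ 2 / φ (P i (T (Q i u)))) / (2 * η)
          + η / 2 * φ (P i (T (Q i u))) := by
      intro i
      have := sum_abs_sub_div_mul_le (hs0 i) (hst i) hη0
      rwa [hsum_s, hsum_t] at this
    have henergy : ∑ i, ∑ k, s i k ^ 2 / t i k ≤ partitionEnergy S T φ u P Q + η ^ 2 := by
      refine le_trans (le_of_eq ?_) (hmax _ _ _ href)
      rw [partitionEnergy, Fintype.sum_prod_type]
      rfl
    calc φ |y| ≤ ∑ i, ((∑ k, s i k ^ 2 / t i k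
            - φ (P i (S (Q i u))) ^ 2 / φ (P i (T (Q i u)))) / (2 * η)
            + η / 2 * φ (P i (T (Q i u)))) := hle.trans (Finset.sum_le_sum fun i _ => hbound i)
      _ = (∑ i, ∑ k, s i k ^ 2 / t i k - partitionEnergy S T φ u P Q) / (2 * η)
            + η / 2 * φ (T u) := by
          rw [Finset.sum_add_distrib, ← Finset.sum_div, Finset.sum_sub_distrib, ← Finset.mul_sum,
            ← map_sum, h.sum_eq T u]
          rfl
      _ ≤ η ^ 2 / (2 * η) + η / 2 * φ (T u) := by
          gcongr
          linarith
      _ = ε := by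
          rw [hη]
          field_simp

/-- The operator `R` approximates `S` on all of `[0, u]`: an element `t` of `[0, u]` is the
midpoint of the component `q u` of `u`, for `q` the projection onto the band generated by
`(2 t - u)⁺`, and of the element `2 t - q u` of `[0, u]`. -/
lemma exists_approx_on_interval (hX : IsSigmaDedekindComplete X) (hY : IsSigmaDedekindComplete Y)
    (hS : ∀ x, 0 ≤ x → 0 ≤ S x) (hST : ∀ x, 0 ≤ x → S x ≤ T x)
    (hT : ∀ x, IsAlmostLimitedWeaklyNull x → Tendsto (fun n => T (x n)) atTop (𝓝 0))
    [IsOrderedModule ℝ Y] (hφ : ∀ y, 0 ≤ y → 0 ≤ φ y) (hu : 0 ≤ u) {ε : ℝ} (hε : 0 < ε) :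
    ∃ R : X →L[ℝ] Y, (∀ x, |(S - R) x| ≤ T |x|) ∧
      (∀ x, IsAlmostLimitedWeaklyNull x → Tendsto (fun n => R (x n)) atTop (𝓝 0)) ∧
      ∀ t, 0 ≤ t → t ≤ u → φ |(S - R) t| ≤ ε := by
  obtain ⟨R, hR0, hRT, hRlim, hRq⟩ := exists_approx_on_components hY hS hST hT hφ hu hε
  have hdom : ∀ x, |(S - R) x| ≤ T |x| := by
    refine abs_map_le_map_abs (S - R).toLinearMap T.toLinearMap (fun x hx => ?_) fun x hx => ?_
    · exact (sub_le_self _ (hR0 x hx)).trans (hST x hx)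
    · change -(S x - R x) ≤ T x
      rw [neg_sub]
      exact (sub_le_self _ (hS x hx)).trans (hRT x hx)
  have hφmono : ∀ {a b}, a ≤ b → φ a ≤ φ b := fun hab =>
    map_mono_of_nonneg (U := φ.toLinearMap) hφ hab
  refine ⟨R, hdom, hRlim, ?_⟩
  have hind : ∀ (n : ℕ) t, 0 ≤ t → t ≤ u → φ |(S - R) t| ≤ ε + (1 / 2) ^ n * φ (T u) := by
    intro n
    induction n with
    | zero =>
      intro t ht htu
      have h1 := hφmono (hdom t)
      rw [abs_of_nonneg ht] at h1
      have h2 : φ (T t) ≤ φ (T u) := hφmono (map_mono_of_nonneg (U := T.toLinearMap)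
        (fun x hx => (hS x hx).trans (hST x hx)) htu)
      rw [pow_zero, one_mul]
      linarith
    | succ n ih =>
      intro t ht htu
      obtain ⟨q, hq, hqv, hqz⟩ := hX.exists_orderProjection (posPart_nonneg (t + t - u))
      have hqd : q (t + t - u) = (t + t - u)⁺ := by
        conv_lhs => rw [← posPart_sub_negPart (t + t - u)]
        rw [map_sub, hqv, hqz _ (negPart_nonneg _) (by
          rw [inf_comm]
          exact posPart_inf_negPart_eq_zero _), sub_zero]
      have hqtu : q t ≤ q u := map_mono_of_nonneg (U := q.toLinearMap) hq.nonneg htu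
      have hqt : q t ≤ t := hq.le_self t ht
      have hlow : 0 ≤ t + t - q u := by
        have h1 : 0 ≤ q t + q t - q u := by
          rw [← map_add, ← map_sub, hqd]
          exact posPart_nonneg _
        exact h1.trans (sub_le_sub_right (add_le_add hqt hqt) _)
      have hup : t + t - q u ≤ u := by
        have h1 : t + t - u ≤ q t + q t - q u := by
          rw [← map_add, ← map_sub, hqd]
          exact le_posPart _
        have h2 : q t + q t - q u ≤ q u := by
          rw [sub_le_iff_le_add]
          exact add_le_add hqtu hqtu
        rw [sub_le_comm]
        exact h1.trans h2
      have h1 := ih _ hlow hup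
      have h2 := hRq q hq
      have h3 : (2 : ℝ) * φ |(S - R) t| ≤ φ |(S - R) (q u)| + φ |(S - R) (t + t - q u)| := by
        rw [two_mul, ← map_add, ← map_add]
        refine hφmono (abs_add_abs_self_le.trans ?_)
        have e2 : (S - R) t + (S - R) t = (S - R) (q u) + (S - R) (t + t - q u) := by
          rw [← map_add, ← map_add]
          congr 1
          abel
        rw [e2]
        exact abs_add_le _ _
      rw [pow_succ]
      linarith
  intro t ht htu
  have hlim : Tendsto (fun n : ℕ => ε + (1 / 2 : ℝ) ^ n * φ (T u)) atTop
      (𝓝 (ε + 0 * φ (T u))) :=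
    ((tendsto_pow_atTop_nhds_zero_of_lt_one (by norm_num) (by norm_num)).mul_const _).const_add _
  rw [zero_mul, add_zero] at hlim
  exact ge_of_tendsto' hlim fun n => hind n t ht htu

end Approximation

/-! ### The domination theorem -/

lemma posPart_inf_add_posPart_sub {Z : Type*} [AddCommGroup Z] [Lattice Z] [IsOrderedAddMonoid Z]
    (x : Z) {u : Z} (hu : 0 ≤ u) : x⁺ ⊓ u + (x - u)⁺ = x⁺ := by
  have h : (x - u)⁺ = (x⁺ - u)⁺ := by
    rw [posPart_def, posPart_def, posPart_def, sup_sub, sup_assoc, zero_sub,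
      sup_eq_right.2 (neg_nonpos.2 hu)]
  rw [h, inf_eq_sub_posPart_sub, sub_add_cancel]

section Domination

variable {X : Type*} [NormedAddCommGroup X] [NormedSpace ℝ X] [CompleteSpace X] [Lattice X]
  [HasSolidNorm X] [IsOrderedAddMonoid X] [IsOrderedModule ℝ X]
  {Y : Type*} [NormedAddCommGroup Y] [NormedSpace ℝ Y] [Lattice Y]
  [HasSolidNorm Y] [IsOrderedAddMonoid Y]

/-- The truncation bound holds for the sequence and its negative with a common `u`. -/
lemma IsAlmostLimitedWeaklyNull.exists_eventually_norm_map_add_le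
    (hX : IsSigmaDedekindComplete X) {T : X →L[ℝ] Y} (hTpos : ∀ x, 0 ≤ x → 0 ≤ T x)
    (hT : ∀ x, IsAlmostLimitedWeaklyNull x → Tendsto (fun n => T (x n)) atTop (𝓝 0))
    {x : ℕ → X} (hx : IsAlmostLimitedWeaklyNull x) {ε : ℝ} (hε : 0 < ε) :
    ∃ u, 0 ≤ u ∧ ∀ᶠ n in atTop, ‖T ((x n - u)⁺ + (-x n - u)⁺)‖ ≤ ε := by
  obtain ⟨u, hu, h1⟩ :=
    hx.exists_eventually_norm_map_posPart_sub_le hX hTpos hT (half_pos hε)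
  obtain ⟨v, hv, h2⟩ :=
    hx.neg.exists_eventually_norm_map_posPart_sub_le hX hTpos hT (half_pos hε)
  have hmono : ∀ y w w' : X, w ≤ w' → ‖T (y - w')⁺‖ ≤ ‖T (y - w)⁺‖ := fun y w w' hw =>
    norm_le_norm_of_nonneg_of_le (hTpos _ (posPart_nonneg _))
      (map_mono_of_nonneg (U := T.toLinearMap) hTpos (posPart_mono (sub_le_sub_left hw y)))
  refine ⟨u + v, add_nonneg hu hv, ?_⟩
  filter_upwards [h1, h2] with n hn1 hn2
  rw [map_add]
  refine (norm_add_le _ _).trans ?_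
  have e1 := hmono (x n) u (u + v) (le_add_of_nonneg_right hv)
  have e2 := hmono (-x n) v (u + v) (le_add_of_nonneg_left hu)
  linarith

variable [IsOrderedModule ℝ Y] {S T : X →L[ℝ] Y}

/-- A dominated operator maps almost limited weakly null sequences to sequences whose moduli are
weakly null. -/
lemma tendsto_dual_abs_of_dominated (hX : IsSigmaDedekindComplete X)
    (hY : IsSigmaDedekindComplete Y) (hS : ∀ x, 0 ≤ x → 0 ≤ S x) (hST : ∀ x, 0 ≤ x → S x ≤ T x)
    (hT : ∀ x, IsAlmostLimitedWeaklyNull x → Tendsto (fun n => T (x n)) atTop (𝓝 0))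
    {x : ℕ → X} (hx : IsAlmostLimitedWeaklyNull x) {φ : StrongDual ℝ Y}
    (hφ : ∀ y, 0 ≤ y → 0 ≤ φ y) : Tendsto (fun n => φ |S (x n)|) atTop (𝓝 0) := by
  have hφmono : ∀ {a b}, a ≤ b → φ a ≤ φ b := fun hab =>
    map_mono_of_nonneg (U := φ.toLinearMap) hφ hab
  have hTpos : ∀ x, 0 ≤ x → 0 ≤ T x := fun x hx => (hS x hx).trans (hST x hx)
  rw [Metric.tendsto_atTop']
  intro ε hε
  obtain ⟨δ, hδ⟩ : ∃ δ, δ = ε / (5 * (1 + ‖φ‖)) := ⟨_, rfl⟩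
  have hδ0 : 0 < δ := by
    rw [hδ]
    positivity
  have hφδ : ‖φ‖ * δ ≤ ε / 5 := by
    have : (1 + ‖φ‖) * δ = ε / 5 := by
      rw [hδ]
      field_simp
    nlinarith [norm_nonneg φ]
  obtain ⟨u, hu, htail⟩ := hx.exists_eventually_norm_map_add_le hX hTpos hT hδ0
  obtain ⟨R, hRT, hRlim, hR⟩ := exists_approx_on_interval hX hY hS hST hT hφ hu
    (ε := ε / 5) (by positivity)
  have hRx : ∀ᶠ n in atTop, φ |R (x n)| < ε / 5 := by
    have h1 : Tendsto (fun n => φ |R (x n)|) atTop (𝓝 (φ |(0 : Y)|)) := by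
      refine (φ.continuous.tendsto _).comp ?_
      have hc : Continuous fun y : Y => |y| := continuous_id.sup continuous_neg
      exact (hc.tendsto 0).comp (hRlim x hx)
    rw [abs_zero, map_zero] at h1
    exact h1.eventually (gt_mem_nhds (by positivity))
  obtain ⟨N, hN⟩ := eventually_atTop.1 (htail.and hRx)
  refine ⟨N, fun n hn => ?_⟩
  obtain ⟨hn1, hn2⟩ := hN n hn.le
  rw [dist_zero_right, Real.norm_of_nonneg (hφ _ (abs_nonneg _))]
  obtain ⟨r, hr⟩ : ∃ r, r = (x n - u)⁺ + (-x n - u)⁺ := ⟨_, rfl⟩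
  rw [← hr] at hn1
  have hdecomp : S (x n) = ((S - R) ((x n)⁺ ⊓ u) - (S - R) ((-x n)⁺ ⊓ u)) +
      ((S - R) ((x n - u)⁺) - (S - R) ((-x n - u)⁺)) + R (x n) := by
    have e : x n = ((x n)⁺ ⊓ u + (x n - u)⁺) - ((-x n)⁺ ⊓ u + (-x n - u)⁺) := by
      rw [posPart_inf_add_posPart_sub _ hu, posPart_inf_add_posPart_sub _ hu, posPart_neg,
        posPart_sub_negPart]
    rw [← map_sub, ← map_sub, ← map_add, ← add_sub_add_comm, ← e]
    simp
  have habs : |S (x n)| ≤ (|(S - R) ((x n)⁺ ⊓ u)| + |(S - R) ((-x n)⁺ ⊓ u)|) +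
      T r + |R (x n)| := by
    rw [hdecomp]
    refine (abs_add_le _ _).trans (add_le_add_left ((abs_add_le _ _).trans (add_le_add ?_ ?_)) _)
    · rw [sub_eq_add_neg, ← abs_neg ((S - R) ((-x n)⁺ ⊓ u))]
      exact abs_add_le _ _
    · rw [hr, map_add, sub_eq_add_neg]
      refine (abs_add_le _ _).trans (add_le_add ?_ ?_)
      · have := hRT (x n - u)⁺
        rwa [abs_of_nonneg (posPart_nonneg _)] at this
      · have := hRT (-x n - u)⁺
        rwa [abs_of_nonneg (posPart_nonneg _), ← abs_neg] at this
  have h1 := hφmono habs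
  rw [map_add, map_add, map_add] at h1
  have h2 := hR ((x n)⁺ ⊓ u) (le_inf (posPart_nonneg _) hu) inf_le_right
  have h3 := hR ((-x n)⁺ ⊓ u) (le_inf (posPart_nonneg _) hu) inf_le_right
  have h4 : φ (T r) ≤ ε / 5 :=
    (le_abs_self _).trans ((φ.le_opNorm _).trans
      ((mul_le_mul_of_nonneg_left hn1 (norm_nonneg _)).trans hφδ))
  linarith

lemma tendsto_zero_of_dominated [CompleteSpace Y] (hX : IsSigmaDedekindComplete X)
    (hY : HasOrderContinuousNorm Y) (hS : ∀ x, 0 ≤ x → 0 ≤ S x)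
    (hST : ∀ x, 0 ≤ x → S x ≤ T x)
    (hT : ∀ x, IsAlmostLimitedWeaklyNull x → Tendsto (fun n => T (x n)) atTop (𝓝 0))
    {x : ℕ → X} (hx : IsAlmostLimitedWeaklyNull x) :
    Tendsto (fun n => S (x n)) atTop (𝓝 0) := by
  have hTpos : ∀ x, 0 ≤ x → 0 ≤ T x := fun x hx => (hS x hx).trans (hST x hx)
  rw [Metric.tendsto_atTop']
  intro ε hε
  obtain ⟨u, hu, htail⟩ := hx.exists_eventually_norm_map_add_le hX hTpos hT
    (ε := ε / 3) (by positivity)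
  obtain ⟨φ, hφ, δ, hδ, hφδ⟩ := hY.exists_dual_norm_le (T (u + u)) (ε := ε / 3) (by positivity)
  have hlim := tendsto_dual_abs_of_dominated hX hY.isSigmaDedekindComplete hS hST hT hx hφ
  obtain ⟨N, hN⟩ := eventually_atTop.1 (htail.and (hlim.eventually (gt_mem_nhds hδ)))
  refine ⟨N, fun n hn => ?_⟩
  obtain ⟨hn1, hn2⟩ := hN n hn.le
  rw [dist_zero_right]
  obtain ⟨r, hr⟩ : ∃ r, r = (x n - u)⁺ + (-x n - u)⁺ := ⟨_, rfl⟩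
  rw [← hr] at hn1
  have hr0 : 0 ≤ T r := by
    rw [hr]
    exact hTpos _ (add_nonneg (posPart_nonneg _) (posPart_nonneg _))
  have hw0 : 0 ≤ T (u + u) := hTpos _ (add_nonneg hu hu)
  have h1 : |S (x n)| ≤ T (u + u) + T r := by
    have e : |x n| ≤ u + u + r := by
      rw [← posPart_add_negPart, ← posPart_neg, ← posPart_inf_add_posPart_sub (x n) hu,
        ← posPart_inf_add_posPart_sub (-x n) hu, hr, add_add_add_comm]
      exact add_le_add_left (add_le_add inf_le_right inf_le_right) _
    rw [← map_add]
    exact (abs_map_le_map_abs S.toLinearMap T.toLinearMap hST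
      (fun x hx => (neg_nonpos.2 (hS x hx)).trans (hTpos x hx)) (x n)).trans
      (map_mono_of_nonneg (U := T.toLinearMap) hTpos e)
  have h2 : |S (x n)| ≤ |S (x n)| ⊓ T (u + u) + T r := by
    rw [inf_add]
    exact le_inf (le_add_of_nonneg_right hr0) h1
  have h3 : ‖|S (x n)| ⊓ T (u + u)‖ ≤ ε / 3 :=
    hφδ _ (le_inf (abs_nonneg _) hw0) inf_le_right
      ((map_mono_of_nonneg (U := φ.toLinearMap) hφ inf_le_left).trans_lt hn2)
  have h4 := (norm_le_norm_of_nonneg_of_le (abs_nonneg _) h2).trans (norm_add_le _ _)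
  rw [norm_abs_eq_norm] at h4
  linarith

end Domination

theorem mainTheorem7
    {E : Type*} [NormedAddCommGroup E] [NormedSpace ℝ E] [CompleteSpace E] [Lattice E]
    [HasSolidNorm E] [IsOrderedAddMonoid E] [IsOrderedModule ℝ E]
    {F : Type*} [NormedAddCommGroup F] [NormedSpace ℝ F] [CompleteSpace F] [Lattice F]
    [HasSolidNorm F] [IsOrderedAddMonoid F] [IsOrderedModule ℝ F]
    (hE : IsSigmaDedekindComplete E) (hF : HasOrderContinuousNorm F)
    (S T : E →ₗ[ℝ] F)
    (hS : ∀ x : E, 0 ≤ x → 0 ≤ S x)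
    (hST : ∀ x : E, 0 ≤ x → S x ≤ T x)
    (hT : IsAlmostLimitedCompletelyContinuous T) :
    IsAlmostLimitedCompletelyContinuous S := by
  let T' : E →L[ℝ] F := ⟨T, hT.continuous⟩
  have hbound : ∀ x, ‖S x‖ ≤ ‖T'‖ * ‖x‖ := fun x => by
    have h1 : |S x| ≤ T |x| := abs_map_le_map_abs S T hST
      (fun x hx => (neg_nonpos.2 (hS x hx)).trans ((hS x hx).trans (hST x hx))) x
    rw [← norm_abs_eq_norm, ← norm_abs_eq_norm x]
    exact (norm_le_norm_of_nonneg_of_le (abs_nonneg _) h1).trans (T'.le_opNorm |x|)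
  let S' : E →L[ℝ] F := S.mkContinuous ‖T'‖ hbound
  refine ⟨S'.continuous, fun x hx hx0 => ?_⟩
  exact tendsto_zero_of_dominated (S := S') (T := T') hE hF hS hST
    (fun y hy => hT.tendsto_zero y hy.isAlmostLimited
      (tendsto_toWeakSpace_zero_iff.2 hy.tendsto_dual))
    ⟨hx, tendsto_toWeakSpace_zero_iff.1 hx0⟩
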